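/- For every dimension $d$ and $a,b\in\mathbb R$ put $\langle x\rangle=(1+|x|^2)^{1/2}$ on $\mathbb R^d$, and let $\langle D\rangle^b$, with $D=-i\partial$, be the operator that acts as multiplication by $\langle\xi\rangle^b=(1+|\xi|^2)^{b/2}$ on the Fourier transform side, where $\hat u(\xi)=\int e^{-ix\cdot\xi}u(x)\,dx$. For $u$ in the Schwartz space $\mathcal S(\mathbb R^d)$ of complex-valued functions set $$\|u\|_{(a,b)}=\big\|\langle x\rangle^a\langle D\rangle^b u\big\|_{L^2(\mathbb R^d)} .$$ Let $T:\mathcal S(\mathbb R^d)\times\mathcal S(\mathbb R^d)\to\mathcal S(\mathbb R^N)$ be a continuous bilinear map, and let $I(T)$ be the set of all $\sigma=(a',b',a'',b'',a,b)\in\mathbb R^6$ for which there is a constant $C=C(\sigma)$ such that $$\|T(f,g)\|_{(a,b)}\le C\,\|f\|_{(a',b')}\,\|g\|_{(a'',b'')}\qquad\text{for all } f,g\in\mathcal S(\mathbb R^d).$$ Here the norm on the left is the one on $\mathbb R^N$. Then $I(T)$ is a convex subset of $\mathbb R^6$. -/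

import Mathlib

open scoped SchwartzMap FourierTransform

noncomputable section

/-- The weight `⟨x⟩ ^ a = (1 + |x|²) ^ (a / 2)` on `ℝ^d`, as a complex-valued function. -/
def japaneseWeight (d : ℕ) (a : ℝ) (x : EuclideanSpace ℝ (Fin d)) : ℂ :=
  (((1 + ‖x‖ ^ 2) ^ (a / 2) : ℝ) : ℂ)

/-- The symbol of `⟨D⟩ ^ b`, `D = -i ∂`, in terms of the Fourier transform
`𝓕 f ξ = ∫ exp (-2 π i x · ξ) f x dx`, under which `D` is multiplication by `2 π ξ`:
it is `ξ ↦ ⟨2 π ξ⟩ ^ b = (1 + |2 π ξ|²) ^ (b / 2)`. -/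
def japaneseSymbol (d : ℕ) (b : ℝ) (ξ : EuclideanSpace ℝ (Fin d)) : ℂ :=
  japaneseWeight d b ((2 * Real.pi) • ξ)

/-- The weight has temperate growth, so that multiplication by it is defined on Schwartz space. -/
theorem japaneseWeight_hasTemperateGrowth (d : ℕ) (a : ℝ) :
    (japaneseWeight d a).HasTemperateGrowth := by
  unfold japaneseWeight
  fun_prop

/-- The symbol has temperate growth, so that its Fourier multiplier is defined on Schwartz space. -/
theorem japaneseSymbol_hasTemperateGrowth (d : ℕ) (b : ℝ) :
    (japaneseSymbol d b).HasTemperateGrowth := by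
  have h : (fun ξ : EuclideanSpace ℝ (Fin d) =>
      ((2 * Real.pi) • ContinuousLinearMap.id ℝ (EuclideanSpace ℝ (Fin d))) ξ).HasTemperateGrowth :=
    ContinuousLinearMap.hasTemperateGrowth _
  exact (japaneseWeight_hasTemperateGrowth d b).comp h

/-- Multiplication by `⟨x⟩ ^ a` on Schwartz space. -/
def weightOp (d : ℕ) (a : ℝ) :
    𝓢(EuclideanSpace ℝ (Fin d), ℂ) →L[ℂ] 𝓢(EuclideanSpace ℝ (Fin d), ℂ) :=
  SchwartzMap.smulLeftCLM ℂ (japaneseWeight d a)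

/-- The operator `⟨D⟩ ^ b` on Schwartz space. -/
def besselOp (d : ℕ) (b : ℝ) :
    𝓢(EuclideanSpace ℝ (Fin d), ℂ) →L[ℂ] 𝓢(EuclideanSpace ℝ (Fin d), ℂ) :=
  SchwartzMap.fourierMultiplierCLM ℂ (japaneseSymbol d b)

/-- The norm `‖u‖_(a,b) = ‖⟨x⟩ ^ a ⟨D⟩ ^ b u‖_{L²(ℝ^d)}` of a Schwartz function `u`. -/
def weightedSobolevNorm (d : ℕ) (a b : ℝ) (u : 𝓢(EuclideanSpace ℝ (Fin d), ℂ)) : ℝ :=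
  ‖(weightOp d a (besselOp d b u)).toLp 2‖

/-- The set `I(T)` of all `σ = (a', b', a'', b'', a, b) ∈ ℝ^6` for which there is a constant `C`
with `‖T(f, g)‖_(a,b) ≤ C ‖f‖_(a',b') ‖g‖_(a'',b'')` for all Schwartz functions `f`, `g`. -/
def boundednessExponents {d N : ℕ}
    (T : 𝓢(EuclideanSpace ℝ (Fin d), ℂ) →ₗ[ℂ] 𝓢(EuclideanSpace ℝ (Fin d), ℂ) →ₗ[ℂ]
      𝓢(EuclideanSpace ℝ (Fin N), ℂ)) : Set (Fin 6 → ℝ) :=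
  {σ | ∃ C : ℝ, ∀ f g : 𝓢(EuclideanSpace ℝ (Fin d), ℂ),
    weightedSobolevNorm N (σ 4) (σ 5) (T f g) ≤
      C * weightedSobolevNorm d (σ 0) (σ 1) f * weightedSobolevNorm d (σ 2) (σ 3) g}

end

/-!
The theorem is an instance of Stein interpolation.  Given `σ, τ ∈ I(T)`, put
`ζ(z) = σ + z (τ - σ)` and let complex powers of `⟨x⟩` and `⟨D⟩` with exponents `ζ(z)` act on both
arguments and on the value of `T` (`conjugatedBilinear`), so that boundedness of `T` at `ζ(z)`
becomes boundedness `L² × L² → L²`.  For fixed Schwartz `f, g` this is a holomorphic function of `z`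
with values in `L²`.  It is bounded by `C (1 + |Im z|) ^ n ‖f‖ ‖g‖` on the lines `Re z = 0` and
`Re z = 1`, and the three lines theorem (`IsStripCurve.norm_toLp_le`) gives the bound at real
`z ∈ [0, 1]`.

On the boundary lines the exponents differ from `σ` or `τ` by imaginary numbers.  Imaginary powers
of `⟨x⟩` do not change absolute values.  Imaginary powers of `⟨D⟩` stand inside a power of `⟨x⟩`, so
one needs that they are bounded on every weighted space `L²(⟨x⟩ ^ (2 a) dx)`, with polynomial growth
of the norm (`exists_l2Seminorm_bracketMul_besselMul_le`).  All derivatives of positive order of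
`log ⟨ξ⟩` are bounded, so the symbol `⟨ξ⟩ ^ (i t)` has bounded derivatives that grow polynomially
in `t`.  Multipliers with such symbols are bounded for `a ∈ ℕ`, by induction on `a`: the commutator
with a coordinate is the multiplier of a derivative of the symbol.  The case `a ≥ 0` follows from
the three lines theorem again, and the case `a < 0` by duality.

Holomorphy is taken in the topology of Schwartz space: a curve is called a strip curve if its
difference quotients converge there and its seminorms grow polynomially in the strip.  This class is
stable under continuous linear and bilinear maps and under multiplication by `⟨x⟩ ^ (α + β z)`, the
latter by a second order Taylor estimate in `z` of all derivatives in `x`.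
-/

section

open Function Filter Topology MeasureTheory

noncomputable section

/-! ### Derivatives of the Japanese bracket -/

section Symbols

variable {E : Type*} [NormedAddCommGroup E] [InnerProductSpace ℝ E]

/-- The logarithm `log ⟨c x⟩ = log (1 + |c x|²) / 2` of the Japanese bracket. -/
def bracketLog (c : ℝ) (x : E) : ℝ := Real.log (1 + ‖c • x‖ ^ 2) / 2

theorem bracketLog_nonneg (c : ℝ) (x : E) : 0 ≤ bracketLog c x := by
  have : 0 ≤ ‖c • x‖ ^ 2 := by positivity
  have := Real.log_nonneg (show 1 ≤ 1 + ‖c • x‖ ^ 2 by linarith)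
  unfold bracketLog
  linarith

/-- The power `⟨c x⟩ ^ a` as an exponential. -/
theorem exp_mul_bracketLog (c a : ℝ) (x : E) :
    Real.exp (a * bracketLog c x) = (1 + ‖c • x‖ ^ 2) ^ (a / 2) := by
  rw [Real.rpow_def_of_pos (by positivity), bracketLog]
  congr 1
  ring

theorem exp_bracketLog_le (c : ℝ) (x : E) :
    Real.exp (bracketLog c x) ≤ (1 + |c|) * (1 + ‖x‖) := by
  have h := exp_mul_bracketLog c 1 x
  rw [one_mul, ← Real.sqrt_eq_rpow] at h
  rw [h, norm_smul, Real.norm_eq_abs]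
  apply Real.sqrt_le_iff.2
  have := abs_nonneg c
  have := norm_nonneg x
  have : 0 ≤ |c| * ‖x‖ := by positivity
  constructor
  · positivity
  · nlinarith

theorem contDiff_bracketLog (c : ℝ) {n : WithTop ℕ∞} :
    ContDiff ℝ n (bracketLog c : E → ℝ) := by
  unfold bracketLog
  refine ContDiff.div_const (ContDiff.log ?_ fun x => by positivity) 2
  exact contDiff_const.add ((contDiff_id.const_smul c).norm_sq ℝ)

/-- The derivatives of `|x|²` are `2 ⟪x, ·⟫`, a constant of norm at most `2`, and zero. -/
theorem norm_iteratedFDeriv_normSq_le (x : E) {i : ℕ} (hi : 1 ≤ i) :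
    ‖iteratedFDeriv ℝ i (fun y : E => ‖y‖ ^ 2) x‖ ≤ 2 * (1 + ‖x‖) := by
  obtain ⟨B, hB, hfd⟩ : ∃ B : E →L[ℝ] E →L[ℝ] ℝ, ‖B‖ ≤ 2 ∧
      fderiv ℝ (fun y : E => ‖y‖ ^ 2) = ⇑B := by
    obtain ⟨B, h1, h2⟩ : ∃ B : E →L[ℝ] E →L[ℝ] ℝ, ‖B‖ ≤ 1 ∧ ∀ x y, B x y = inner ℝ x y :=
      ⟨innerSL ℝ, norm_innerSL_le (𝕜 := ℝ) (E := E), fun _ _ => rfl⟩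
    refine ⟨B + B, (norm_add_le B B).trans (by linarith), ?_⟩
    rw [fderiv_norm_sq]
    ext y v
    simp [two_smul, h2]
  obtain ⟨j, rfl⟩ := Nat.exists_eq_add_of_le' hi
  rw [← norm_iteratedFDeriv_fderiv, hfd]
  have hx := norm_nonneg x
  match j with
  | 0 =>
    rw [norm_iteratedFDeriv_zero]
    refine (B.le_opNorm _).trans ?_
    nlinarith
  | 1 =>
    rw [norm_iteratedFDeriv_one, ContinuousLinearMap.fderiv]
    linarith
  | k + 2 =>
    rw [← norm_iteratedFDeriv_fderiv]
    have : fderiv ℝ ⇑B = fun _ => B := by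
      ext1 v; simp only [ContinuousLinearMap.fderiv]
    rw [this, iteratedFDeriv_const_of_ne (by omega), Pi.zero_apply, norm_zero]
    linarith

/-- All derivatives of positive order of `log ⟨c x⟩` are bounded.  Near `x₀` one writes
`log (1 + |c x|²)` as a constant plus `log` of the quotient `(1 + |c x|²) / (1 + |c x₀|²)`, which
takes the value `1` at `x₀` and whose derivatives at `x₀` are bounded uniformly in `x₀`. -/
theorem exists_norm_iteratedFDeriv_bracketLog_le (c : ℝ) (n : ℕ) :
    ∃ D : ℝ, 1 ≤ D ∧ ∀ i, 1 ≤ i → i ≤ n → ∀ x : E,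
      ‖iteratedFDeriv ℝ i (bracketLog c : E → ℝ) x‖ ≤ D ^ i := by
  -- `A` bounds the derivatives of the quotient `f` below at `x₀`, and `B` those of `log` at `1`.
  set A : ℝ := 4 * (1 + c ^ 2)
  set B : ℝ := ∑ i ∈ Finset.range (n + 1), ‖iteratedFDeriv ℝ i Real.log 1‖
  have hB : 0 ≤ B := Finset.sum_nonneg fun _ _ => norm_nonneg _
  have hA : 1 ≤ A := by simp only [A]; nlinarith [sq_nonneg c]
  set K : ℝ := n.factorial * B * A ^ n
  have hK : 0 ≤ K := by positivity
  refine ⟨1 + K, by linarith, fun i hi hin x₀ => ?_⟩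
  set r : ℝ := 1 + ‖c • x₀‖ ^ 2 with hr
  have hr1 : 1 ≤ r := by simp only [hr]; nlinarith [sq_nonneg ‖c • x₀‖]
  set f : E → ℝ := fun x => r⁻¹ * (1 + c ^ 2 * ‖x‖ ^ 2) with hf
  have hfx : f x₀ = 1 := by
    have : 1 + c ^ 2 * ‖x₀‖ ^ 2 = r := by
      rw [hr, norm_smul, mul_pow, Real.norm_eq_abs, sq_abs]
    simp only [hf]
    rw [this]
    exact inv_mul_cancel₀ (by positivity)
  have hnsq : ContDiff ℝ i (fun x : E => ‖x‖ ^ 2) := contDiff_id.norm_sq ℝ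
  have hfc : ContDiff ℝ i f := by
    exact contDiff_const.mul (contDiff_const.add (contDiff_const.mul hnsq))
  have hfd : ∀ j, 1 ≤ j → j ≤ i → ‖iteratedFDeriv ℝ j f x₀‖ ≤ A ^ j := by
    intro j hj hji
    have hnj : ContDiff ℝ j (fun x : E => ‖x‖ ^ 2) := contDiff_id.norm_sq ℝ
    have e : f = (fun _ => r⁻¹) + (r⁻¹ * c ^ 2) • (fun x : E => ‖x‖ ^ 2) := by
      ext x; simp [hf]; ring
    rw [e, iteratedFDeriv_add contDiff_const
        (show ContDiff ℝ j ((r⁻¹ * c ^ 2) • fun x : E => ‖x‖ ^ 2) from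
          hnj.const_smul (r⁻¹ * c ^ 2)), Pi.add_apply,
      iteratedFDeriv_const_of_ne (by omega), iteratedFDeriv_const_smul_apply hnj.contDiffAt]
    rw [Pi.zero_apply, zero_add, norm_smul, Real.norm_of_nonneg (by positivity)]
    have h1 := norm_iteratedFDeriv_normSq_le x₀ hj
    have hr0 : 0 < r := by linarith
    calc r⁻¹ * c ^ 2 * ‖iteratedFDeriv ℝ j (fun x : E => ‖x‖ ^ 2) x₀‖
        ≤ r⁻¹ * c ^ 2 * (2 * (1 + ‖x₀‖)) := by gcongr
      _ ≤ A := by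
        rw [mul_assoc, inv_mul_le_iff₀ hr0]
        have : r = 1 + c ^ 2 * ‖x₀‖ ^ 2 := by
          rw [hr, norm_smul, mul_pow, Real.norm_eq_abs, sq_abs]
        rw [this]
        simp only [A]
        nlinarith [sq_nonneg (‖x₀‖ - 1), sq_nonneg c, sq_nonneg (c * ‖x₀‖),
          mul_nonneg (sq_nonneg c) (sq_nonneg (‖x₀‖ - 1)), sq_nonneg (c ^ 2 * ‖x₀‖)]
      _ ≤ A ^ j := le_self_pow₀ hA (by omega)
  have hlog : ContDiffOn ℝ i Real.log (Set.Ioi 0) :=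
    Real.contDiffOn_log.mono fun x hx => ne_of_gt hx |>.elim
  have hun : UniqueDiffOn ℝ (Set.Ioi (0 : ℝ)) := isOpen_Ioi.uniqueDiffOn
  have hcomp := norm_iteratedFDeriv_comp_le' (g := Real.log) (f := f) (n := i) (N := i)
    (t := Set.Ioi 0) (by rintro _ ⟨x, rfl⟩; simp only [hf, Set.mem_Ioi]; positivity) hun hlog hfc
    le_rfl x₀ (C := B) (D := A) (by
      intro j hj
      rw [hfx, iteratedFDerivWithin_of_isOpen j isOpen_Ioi (by simp)]
      exact Finset.single_le_sum (f := fun i => ‖iteratedFDeriv ℝ i Real.log 1‖)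
        (fun _ _ => norm_nonneg _) (by simp; omega)) hfd
  have e2 : (bracketLog c : E → ℝ)
      = (fun _ => Real.log r / 2) + (2⁻¹ : ℝ) • (Real.log ∘ f) := by
    ext x
    simp only [bracketLog, Pi.add_apply, Pi.smul_apply, comp_apply, hf, smul_eq_mul]
    rw [Real.log_mul (by positivity) (by positivity), Real.log_inv, norm_smul, mul_pow,
      Real.norm_eq_abs, sq_abs]
    ring
  have hlf : ContDiff ℝ i (Real.log ∘ f) :=
    hfc.log fun x => by simp only [hf]; positivity
  rw [e2, iteratedFDeriv_add contDiff_const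
      (show ContDiff ℝ i ((2⁻¹ : ℝ) • (Real.log ∘ f)) from
        hlf.const_smul (2⁻¹ : ℝ)), Pi.add_apply,
      iteratedFDeriv_const_of_ne (by omega), iteratedFDeriv_const_smul_apply hlf.contDiffAt]
  rw [Pi.zero_apply, zero_add, norm_smul, Real.norm_of_nonneg (by positivity)]
  have h3 : (i.factorial : ℝ) * B * A ^ i ≤ K := by
    have : i.factorial ≤ n.factorial := Nat.factorial_le hin
    have : A ^ i ≤ A ^ n := pow_le_pow_right₀ hA hin
    simp only [K]
    gcongr
  have h4 : 1 + K ≤ (1 + K) ^ i := le_self_pow₀ (by linarith) (by omega)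
  linarith [norm_nonneg (iteratedFDeriv ℝ i (Real.log ∘ f) x₀)]

/-- Derivative bounds for functions of `log ⟨c x⟩`.  The bound at `x` only involves the derivatives
of `g` at the single point `log ⟨c x⟩`, so that `K` may depend on `x`. -/
theorem exists_norm_iteratedFDeriv_comp_bracketLog_le (c : ℝ) (n : ℕ) :
    ∃ A : ℝ, 1 ≤ A ∧ ∀ g : ℝ → ℂ, ContDiff ℝ (⊤ : ℕ∞) g → ∀ (x : E) (K : ℝ),
      (∀ j ≤ n, ‖iteratedDeriv j g (bracketLog c x)‖ ≤ K) →
      ∀ i ≤ n, ‖iteratedFDeriv ℝ i (fun y : E => g (bracketLog c y)) x‖ ≤ A * K := by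
  obtain ⟨D, hD, hb⟩ := exists_norm_iteratedFDeriv_bracketLog_le (E := E) c n
  refine ⟨n.factorial * D ^ n, ?_, fun g hg x K hK i hi => ?_⟩
  · have h1 : (1 : ℝ) ≤ n.factorial := by exact_mod_cast n.factorial_pos
    have h2 : 1 ≤ D ^ n := one_le_pow₀ hD
    nlinarith
  have hK0 : 0 ≤ K := (norm_nonneg _).trans (hK 0 (by omega))
  have h := norm_iteratedFDeriv_comp_le (𝕜 := ℝ) (g := g) (f := (bracketLog c : E → ℝ)) (n := i)
    (N := (⊤ : ℕ∞)) hg (contDiff_bracketLog c) (by exact_mod_cast le_top) x (C := K) (D := D)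
    (fun j hj => by
      rw [norm_iteratedFDeriv_eq_norm_iteratedDeriv]; exact hK j (by omega))
    (fun j hj hji => hb j hj (by omega) x)
  refine h.trans ?_
  have h1 : (i.factorial : ℝ) ≤ n.factorial := by exact_mod_cast Nat.factorial_le hi
  have h2 : D ^ i ≤ D ^ n := pow_le_pow_right₀ hD hi
  calc (i.factorial : ℝ) * K * D ^ i ≤ n.factorial * K * D ^ n := by gcongr
    _ = _ := by ring

theorem contDiff_cexp_mul_ofReal (z : ℂ) {n : WithTop ℕ∞} :
    ContDiff ℝ n fun t : ℝ => Complex.exp (z * t) :=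
  (contDiff_const.mul Complex.ofRealCLM.contDiff).cexp

theorem deriv_cexp_mul_ofReal (z : ℂ) :
    deriv (fun t : ℝ => Complex.exp (z * t)) = fun t : ℝ => z * Complex.exp (z * t) := by
  ext t
  have h : HasDerivAt (fun t : ℝ => z * (t : ℂ)) z t := by
    simpa using (Complex.ofRealCLM.hasDerivAt (x := t)).const_mul z
  rw [h.cexp.deriv, mul_comm]

theorem iteratedDeriv_cexp_mul_ofReal (z : ℂ) (j : ℕ) :
    iteratedDeriv j (fun t : ℝ => Complex.exp (z * t))
      = fun t : ℝ => z ^ j * Complex.exp (z * t) := by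
  induction j with
  | zero => simp
  | succ j ih =>
    rw [iteratedDeriv_succ, ih]
    ext t
    rw [deriv_const_mul_field, deriv_cexp_mul_ofReal]
    ring

theorem norm_iteratedDeriv_cexp_mul_ofReal_le (z : ℂ) {j n : ℕ} (hj : j ≤ n) (t : ℝ) :
    ‖iteratedDeriv j (fun t : ℝ => Complex.exp (z * t)) t‖
      ≤ (1 + ‖z‖) ^ n * Real.exp (z.re * t) := by
  rw [iteratedDeriv_cexp_mul_ofReal, norm_mul, norm_pow, Complex.norm_exp]
  have h1 : ‖z‖ ^ j ≤ (1 + ‖z‖) ^ n :=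
    (pow_le_pow_left₀ (norm_nonneg z) (by linarith) j).trans
      (pow_le_pow_right₀ (by linarith [norm_nonneg z]) hj)
  simp
  gcongr

/-- The derivatives of the second order Taylor remainder of `w ↦ exp (w t)` at `w = 0`. -/
theorem norm_iteratedDeriv_cexp_remainder_le {w : ℂ} (hw : ‖w‖ ≤ 1) (j : ℕ) {t : ℝ} (ht : 0 ≤ t) :
    ‖iteratedDeriv j (fun t : ℝ => Complex.exp (w * t) - 1 - w * t) t‖
      ≤ ‖w‖ ^ 2 * Real.exp (3 * t) := by
  have hn : ‖w * (t : ℂ)‖ = ‖w‖ * t := by rw [norm_mul]; simp [abs_of_nonneg ht]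
  have ht1 : t ≤ Real.exp t := by linarith [Real.add_one_le_exp t]
  have hwt : ‖w‖ * t ≤ t := by nlinarith
  have he : Real.exp (‖w‖ * t) ≤ Real.exp t := Real.exp_le_exp.2 hwt
  have he1 : 1 ≤ Real.exp t := Real.one_le_exp ht
  have h3 : Real.exp (3 * t) = Real.exp t ^ 3 := by rw [← Real.exp_nat_mul]; norm_num
  have hd : deriv (fun t : ℝ => Complex.exp (w * t) - 1 - w * t)
      = fun t : ℝ => w * (Complex.exp (w * t) - 1) := by
    ext s
    have h : HasDerivAt (fun t : ℝ => w * (t : ℂ)) w s := by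
      simpa using (Complex.ofRealCLM.hasDerivAt (x := s)).const_mul w
    have h2 : HasDerivAt (fun t : ℝ => Complex.exp (w * t) - 1 - w * t)
        (Complex.exp (w * s) * w - w) s := (h.cexp.sub_const 1).sub h
    rw [h2.deriv]
    ring
  have hd2 : deriv (fun t : ℝ => w * (Complex.exp (w * t) - 1))
      = fun t : ℝ => w * (w * Complex.exp (w * t)) := by
    ext s
    rw [deriv_const_mul_field, deriv_sub_const, deriv_cexp_mul_ofReal]
  rw [h3]
  match j with
  | 0 =>
    have := Complex.norm_exp_sub_sum_le_norm_mul_exp (w * t) 2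
    simp only [Finset.sum_range_succ, Finset.range_zero, Finset.sum_empty, hn] at this
    simp only [iteratedDeriv_zero]
    calc _ = _ := by congr 1; simp; ring
      _ ≤ (‖w‖ * t) ^ 2 * Real.exp (‖w‖ * t) := this
      _ ≤ (‖w‖ * Real.exp t) ^ 2 * Real.exp t := by gcongr
      _ = _ := by ring
  | 1 =>
    have := Complex.norm_exp_sub_sum_le_norm_mul_exp (w * t) 1
    simp only [Finset.sum_range_succ, Finset.range_zero, Finset.sum_empty, hn] at this
    rw [iteratedDeriv_one, hd, norm_mul]
    calc _ = ‖w‖ * ‖_‖ := by congr 2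
      _ ≤ ‖w‖ * ((‖w‖ * t) ^ 1 * Real.exp (‖w‖ * t)) := by
        gcongr
        simpa using this
      _ ≤ ‖w‖ * ((‖w‖ * Real.exp t) ^ 1 * Real.exp t) := by gcongr
      _ = ‖w‖ ^ 2 * Real.exp t ^ 2 := by ring
      _ ≤ ‖w‖ ^ 2 * Real.exp t ^ 3 := by gcongr; norm_num
  | k + 2 =>
    rw [iteratedDeriv_succ', iteratedDeriv_succ', hd, hd2, iteratedDeriv_const_mul_field,
      iteratedDeriv_const_mul_field, iteratedDeriv_cexp_mul_ofReal, norm_mul, norm_mul, norm_mul,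
      norm_pow]
    have : ‖Complex.exp (w * t)‖ ≤ Real.exp t :=
      (Complex.norm_exp_le_exp_norm _).trans (by rw [hn]; exact he)
    have h4 : ‖w‖ ^ k ≤ 1 := pow_le_one₀ (norm_nonneg _) hw
    calc _ ≤ ‖w‖ * (‖w‖ * (1 * Real.exp t)) := by gcongr
      _ = ‖w‖ ^ 2 * Real.exp t ^ 1 := by ring
      _ ≤ _ := by gcongr; norm_num

/-- The weight `⟨c x⟩ ^ z`, for a complex exponent `z`. -/
def bracketPow (c : ℝ) (z : ℂ) (x : E) : ℂ := Complex.exp (z * bracketLog c x)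

theorem norm_bracketPow (c : ℝ) (z : ℂ) (x : E) :
    ‖bracketPow c z x‖ = Real.exp (z.re * bracketLog c x) := by
  rw [bracketPow, Complex.norm_exp]
  simp

theorem bracketPow_add (c : ℝ) (z w : ℂ) :
    (bracketPow c (z + w) : E → ℂ) = bracketPow c z * bracketPow c w := by
  ext x
  simp only [bracketPow, Pi.mul_apply]
  rw [← Complex.exp_add]
  ring_nf

@[simp]
theorem bracketPow_zero (c : ℝ) : (bracketPow c 0 : E → ℂ) = fun _ => 1 := by
  ext x
  simp [bracketPow]

theorem exp_mul_bracketLog_le {c s : ℝ} {R : ℕ} (hs : s ≤ R) (x : E) :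
    Real.exp (s * bracketLog c x) ≤ (1 + |c|) ^ R * (1 + ‖x‖) ^ R := by
  rw [← mul_pow]
  calc Real.exp (s * bracketLog c x) ≤ Real.exp (R * bracketLog c x) :=
        Real.exp_le_exp.2 (mul_le_mul_of_nonneg_right hs (bracketLog_nonneg c x))
    _ = Real.exp (bracketLog c x) ^ R := by rw [Real.exp_nat_mul]
    _ ≤ _ := pow_le_pow_left₀ (Real.exp_nonneg _) (exp_bracketLog_le c x) R

/-- The derivatives of `⟨c x⟩ ^ z` are `O(⟨c x⟩ ^ (Re z))`, with polynomial dependence on `z`. -/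
theorem exists_norm_iteratedFDeriv_bracketPow_le (c : ℝ) (n : ℕ) :
    ∃ A : ℝ, 1 ≤ A ∧ ∀ (z : ℂ) (x : E), ∀ i ≤ n,
      ‖iteratedFDeriv ℝ i (bracketPow c z : E → ℂ) x‖
        ≤ A * ((1 + ‖z‖) ^ n * Real.exp (z.re * bracketLog c x)) := by
  obtain ⟨A, hA, h⟩ := exists_norm_iteratedFDeriv_comp_bracketLog_le (E := E) c n
  exact ⟨A, hA, fun z x i hi => h _ (contDiff_cexp_mul_ofReal z) x _
    (fun j hj => norm_iteratedDeriv_cexp_mul_ofReal_le z hj _) i hi⟩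

theorem contDiff_bracketPow (c : ℝ) (z : ℂ) {n : WithTop ℕ∞} :
    ContDiff ℝ n (bracketPow c z : E → ℂ) :=
  (contDiff_cexp_mul_ofReal z).comp (contDiff_bracketLog c)

@[fun_prop]
theorem hasTemperateGrowth_bracketPow (c : ℝ) (z : ℂ) :
    (bracketPow c z : E → ℂ).HasTemperateGrowth := by
  refine ⟨contDiff_bracketPow c z, fun n => ?_⟩
  obtain ⟨A, hA, h⟩ := exists_norm_iteratedFDeriv_bracketPow_le (E := E) c n
  obtain ⟨R, hR⟩ := exists_nat_ge z.re
  refine ⟨R, A * ((1 + ‖z‖) ^ n * (1 + |c|) ^ R), fun x => (h z x n le_rfl).trans ?_⟩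
  have := exp_mul_bracketLog_le (c := c) hR x
  calc _ ≤ A * ((1 + ‖z‖) ^ n * ((1 + |c|) ^ R * (1 + ‖x‖) ^ R)) := by gcongr
    _ = _ := by ring

@[fun_prop]
theorem hasTemperateGrowth_bracketLog (c : ℝ) :
    (fun x : E => (bracketLog c x : ℂ)).HasTemperateGrowth := by
  refine ⟨Complex.ofRealCLM.contDiff.comp (contDiff_bracketLog c), fun n => ?_⟩
  obtain ⟨A, hA, h⟩ := exists_norm_iteratedFDeriv_comp_bracketLog_le (E := E) c n
  refine ⟨1, A * (1 + |c|), fun x => ?_⟩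
  have h0 := bracketLog_nonneg c x
  refine (h (fun t => (t : ℂ)) Complex.ofRealCLM.contDiff x ((1 + |c|) * (1 + ‖x‖)) ?_ n
    le_rfl).trans (by rw [pow_one]; linarith)
  have h1 := exp_bracketLog_le c x
  have h2 := Real.add_one_le_exp (bracketLog c x)
  have hd : deriv (fun t : ℝ => (t : ℂ)) = fun _ => 1 := by
    ext t
    exact (Complex.ofRealCLM.hasDerivAt (x := t)).deriv
  intro j _
  match j with
  | 0 =>
    simp [abs_of_nonneg h0]
    linarith
  | j + 1 =>
    rw [iteratedDeriv_succ', hd, iteratedDeriv_const]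
    split_ifs
    · simp
      linarith
    · simp
      positivity

end Symbols

/-! ### Multiplication operators in Schwartz seminorms -/

section Multipliers

variable {E : Type*} [NormedAddCommGroup E] [InnerProductSpace ℝ E]

/-- Multiplication by a function whose derivatives up to order `n` are at most `K (1 + |x|) ^ l`
is bounded by `K` in Schwartz seminorms, uniformly in the function. -/
theorem seminorm_smulLeftCLM_le {φ : E → ℂ} (hφ : φ.HasTemperateGrowth) {k n l : ℕ} {K : ℝ}
    (hK : 0 ≤ K) (h : ∀ i ≤ n, ∀ x, ‖iteratedFDeriv ℝ i φ x‖ ≤ K * (1 + ‖x‖) ^ l)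
    (u : 𝓢(E, ℂ)) :
    SchwartzMap.seminorm ℂ k n (SchwartzMap.smulLeftCLM ℂ φ u)
      ≤ 2 ^ n * 2 ^ (k + l) * K *
        (Finset.Iic (k + l, n)).sup (schwartzSeminormFamily ℂ E ℂ) u := by
  set Q := (Finset.Iic (k + l, n)).sup (schwartzSeminormFamily ℂ E ℂ) u with hQ
  have hQ0 : 0 ≤ Q := apply_nonneg _ _
  refine SchwartzMap.seminorm_le_bound ℂ k n _ (by positivity) fun x => ?_
  rw [SchwartzMap.smulLeftCLM_apply hφ]
  have h1 := norm_iteratedFDeriv_smul_le (𝕜 := ℝ) (N := (⊤ : ℕ∞)) hφ.1 (u.smooth ⊤) x (n := n)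
    (by exact_mod_cast le_top)
  have hx : ‖x‖ ^ k ≤ (1 + ‖x‖) ^ k := pow_le_pow_left₀ (norm_nonneg x) (by linarith) k
  calc ‖x‖ ^ k * ‖iteratedFDeriv ℝ n (fun y => φ y • u y) x‖
      ≤ (1 + ‖x‖) ^ k * ∑ i ∈ Finset.range (n + 1), (n.choose i : ℝ) *
          ‖iteratedFDeriv ℝ i φ x‖ * ‖iteratedFDeriv ℝ (n - i) u x‖ := by gcongr
    _ = ∑ i ∈ Finset.range (n + 1), (1 + ‖x‖) ^ k * ((n.choose i : ℝ) *
          ‖iteratedFDeriv ℝ i φ x‖ * ‖iteratedFDeriv ℝ (n - i) u x‖) := Finset.mul_sum ..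
    _ ≤ ∑ i ∈ Finset.range (n + 1), (n.choose i : ℝ) * (2 ^ (k + l) * K * Q) := by
        refine Finset.sum_le_sum fun i hi => ?_
        have hi' : i ≤ n := by simp at hi; omega
        have h2 := SchwartzMap.one_add_le_sup_seminorm_apply (𝕜 := ℂ) (m := (k + l, n))
          (k := k + l) (n := n - i) le_rfl (Nat.sub_le n i) u x
        calc (1 + ‖x‖) ^ k * ((n.choose i : ℝ) *
              ‖iteratedFDeriv ℝ i φ x‖ * ‖iteratedFDeriv ℝ (n - i) u x‖)
            ≤ (1 + ‖x‖) ^ k * ((n.choose i : ℝ) *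
              (K * (1 + ‖x‖) ^ l) * ‖iteratedFDeriv ℝ (n - i) u x‖) := by
              gcongr
              exact h i hi' x
          _ = (n.choose i : ℝ) * K * ((1 + ‖x‖) ^ (k + l) * ‖iteratedFDeriv ℝ (n - i) u x‖) := by
              rw [pow_add]; ring
          _ ≤ (n.choose i : ℝ) * K * (2 ^ (k + l) * Q) :=
              mul_le_mul_of_nonneg_left h2 (by positivity)
          _ = _ := by ring
    _ = 2 ^ n * 2 ^ (k + l) * K * Q := by
        rw [← Finset.sum_mul]
        have := Nat.sum_range_choose n
        have h3 : ∑ i ∈ Finset.range (n + 1), (n.choose i : ℝ) = 2 ^ n := by exact_mod_cast this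
        rw [h3]; ring

/-- Multiplication by `⟨c x⟩ ^ z` on Schwartz space.  The symbol has temperate growth by
`hasTemperateGrowth_bracketPow`, so `smulLeftCLM` does not take its default value `0`. -/
def bracketMul (c : ℝ) (z : ℂ) : 𝓢(E, ℂ) →L[ℂ] 𝓢(E, ℂ) :=
  SchwartzMap.smulLeftCLM ℂ (bracketPow c z)

theorem bracketMul_apply (c : ℝ) (z : ℂ) (u : 𝓢(E, ℂ)) (x : E) :
    bracketMul c z u x = bracketPow c z x * u x := by
  rw [bracketMul, SchwartzMap.smulLeftCLM_apply_apply (hasTemperateGrowth_bracketPow c z),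
    smul_eq_mul]

theorem bracketMul_bracketMul (c : ℝ) (z w : ℂ) (u : 𝓢(E, ℂ)) :
    bracketMul c z (bracketMul c w u) = bracketMul c (z + w) u := by
  ext x
  simp only [bracketMul_apply, bracketPow_add, Pi.mul_apply]
  ring

@[simp]
theorem bracketMul_zero (c : ℝ) (u : 𝓢(E, ℂ)) : bracketMul c 0 u = u := by
  ext x
  simp [bracketMul_apply]

/-- The operators `⟨c x⟩ ^ z` are equicontinuous on Schwartz space for `Re z` bounded, up to
polynomial growth in `z`. -/
theorem exists_seminorm_bracketMul_le (c : ℝ) (k n R : ℕ) :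
    ∃ (C : ℝ) (l : ℕ), 0 ≤ C ∧ ∀ z : ℂ, z.re ≤ R → ∀ u : 𝓢(E, ℂ),
      SchwartzMap.seminorm ℂ k n (bracketMul c z u) ≤ C * (1 + ‖z‖) ^ n *
        (Finset.Iic (l, n)).sup (schwartzSeminormFamily ℂ E ℂ) u := by
  obtain ⟨A, hA, h⟩ := exists_norm_iteratedFDeriv_bracketPow_le (E := E) c n
  refine ⟨2 ^ n * 2 ^ (k + R) * (A * (1 + |c|) ^ R), k + R, by positivity, fun z hz u => ?_⟩
  refine (seminorm_smulLeftCLM_le (hasTemperateGrowth_bracketPow c z) (l := R)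
    (K := A * (1 + |c|) ^ R * (1 + ‖z‖) ^ n) (by positivity) (fun i hi x => ?_) u).trans
    (le_of_eq (by ring))
  have h1 := exp_mul_bracketLog_le (c := c) hz x
  calc _ ≤ A * ((1 + ‖z‖) ^ n * Real.exp (z.re * bracketLog c x)) := h z x i hi
    _ ≤ A * ((1 + ‖z‖) ^ n * ((1 + |c|) ^ R * (1 + ‖x‖) ^ R)) := by gcongr
    _ = _ := by ring

/-- Multiplication by `log ⟨c x⟩` on Schwartz space. -/
def bracketLogMul (c : ℝ) : 𝓢(E, ℂ) →L[ℂ] 𝓢(E, ℂ) :=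
  SchwartzMap.smulLeftCLM ℂ fun x => (bracketLog c x : ℂ)

/-- Second order Taylor estimate for `w ↦ ⟨c x⟩ ^ w u` at `w = 0`, in Schwartz seminorms. -/
theorem exists_seminorm_bracketMul_remainder_le (c : ℝ) (k n : ℕ) :
    ∃ (C : ℝ) (l : ℕ), 0 ≤ C ∧ ∀ w : ℂ, ‖w‖ ≤ 1 → ∀ u : 𝓢(E, ℂ),
      SchwartzMap.seminorm ℂ k n (bracketMul c w u - u - w • bracketLogMul c u) ≤ C * ‖w‖ ^ 2 *
        (Finset.Iic (l, n)).sup (schwartzSeminormFamily ℂ E ℂ) u := by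
  obtain ⟨A, hA, h⟩ := exists_norm_iteratedFDeriv_comp_bracketLog_le (E := E) c n
  refine ⟨2 ^ n * 2 ^ (k + 3) * (A * (1 + |c|) ^ 3), k + 3, by positivity, fun w hw u => ?_⟩
  have hg : (fun x : E => bracketPow c w x - 1 - w * bracketLog c x).HasTemperateGrowth := by
    fun_prop
  have e : bracketMul c w u - u - w • bracketLogMul c u
      = SchwartzMap.smulLeftCLM ℂ (fun x : E => bracketPow c w x - 1 - w * bracketLog c x) u := by
    ext x
    rw [SchwartzMap.smulLeftCLM_apply_apply hg]
    simp only [sub_apply, smul_apply, bracketMul_apply, bracketLogMul,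
      SchwartzMap.smulLeftCLM_apply_apply (hasTemperateGrowth_bracketLog c), smul_eq_mul]
    ring
  rw [e]
  refine (seminorm_smulLeftCLM_le hg (l := 3)
    (K := A * (1 + |c|) ^ 3 * ‖w‖ ^ 2) (by positivity) (fun i hi x => ?_) u).trans
    (le_of_eq (by ring))
  have h1 := exp_mul_bracketLog_le (c := c) (s := 3) (R := 3) (by norm_num) x
  have hsm : ContDiff ℝ (⊤ : ℕ∞) fun t : ℝ => Complex.exp (w * t) - 1 - w * t :=
    ((contDiff_cexp_mul_ofReal w).sub contDiff_const).sub
      (contDiff_const.mul Complex.ofRealCLM.contDiff)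
  calc _ ≤ A * (‖w‖ ^ 2 * Real.exp (3 * bracketLog c x)) :=
        h _ hsm x _ (fun j _ => norm_iteratedDeriv_cexp_remainder_le hw j (bracketLog_nonneg c x))
          i hi
    _ ≤ A * (‖w‖ ^ 2 * ((1 + |c|) ^ 3 * (1 + ‖x‖) ^ 3)) := by gcongr
    _ = _ := by ring

end Multipliers

/-! ### Holomorphic curves in Schwartz space -/

section Curves

variable {E F : Type*} [NormedAddCommGroup E] [InnerProductSpace ℝ E]
  [NormedAddCommGroup F] [InnerProductSpace ℝ F]

/-- A holomorphic curve in Schwartz space all of whose seminorms grow at most polynomially in the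
strip `|Re z| ≤ 1`.  Holomorphy means that the difference quotients converge in the topology of
Schwartz space. -/
structure IsStripCurve (v : ℂ → 𝓢(E, ℂ)) : Prop where
  exists_slope : ∀ z, ∃ v', Tendsto (slope v z) (𝓝[≠] z) (𝓝 v')
  growth : ∀ k n, ∃ (C : ℝ) (m : ℕ), ∀ z : ℂ, |z.re| ≤ 1 →
    SchwartzMap.seminorm ℂ k n (v z) ≤ C * (1 + ‖z‖) ^ m

theorem tendsto_of_tendsto_slope {V : Type*} [AddCommGroup V] [Module ℂ V] [TopologicalSpace V]
    [ContinuousAdd V] [ContinuousSMul ℂ V] {f : ℂ → V} {z : ℂ} {f' : V}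
    (h : Tendsto (slope f z) (𝓝[≠] z) (𝓝 f')) : Tendsto f (𝓝[≠] z) (𝓝 (f z)) := by
  have h1 : Tendsto (fun y : ℂ => y - z) (𝓝[≠] z) (𝓝 0) := by
    have : Tendsto (fun y : ℂ => y - z) (𝓝 z) (𝓝 (z - z)) := tendsto_id.sub_const z
    rw [sub_self] at this
    exact this.mono_left nhdsWithin_le_nhds
  have h2 := (h1.smul h).add_const (f z)
  rw [zero_smul, zero_add] at h2
  refine h2.congr fun y => ?_
  rw [sub_smul_slope]
  simp

theorem isStripCurve_const (u : 𝓢(E, ℂ)) : IsStripCurve fun _ => u where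
  exists_slope z := by
    refine ⟨0, tendsto_const_nhds.congr fun y => ?_⟩
    simp [slope]
  growth k n := ⟨SchwartzMap.seminorm ℂ k n u, 0, fun z _ => by simp⟩

theorem IsStripCurve.growth_sup {v : ℂ → 𝓢(E, ℂ)} (hv : IsStripCurve v) (s : Finset (ℕ × ℕ)) :
    ∃ (C : ℝ) (m : ℕ), 0 ≤ C ∧ ∀ z : ℂ, |z.re| ≤ 1 →
      s.sup (schwartzSeminormFamily ℂ E ℂ) (v z) ≤ C * (1 + ‖z‖) ^ m := by
  classical
  induction s using Finset.induction_on with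
  | empty => exact ⟨0, 0, le_rfl, fun z _ => by simp⟩
  | insert i s hi ih =>
    obtain ⟨C, m, hC, h⟩ := ih
    obtain ⟨C', m', h'⟩ := hv.growth i.1 i.2
    refine ⟨|C'| + C, m' + m, by positivity, fun z hz => ?_⟩
    rw [Finset.sup_insert, Seminorm.sup_apply]
    have h1 : 1 ≤ 1 + ‖z‖ := by linarith [norm_nonneg z]
    have h2 : (1 + ‖z‖) ^ m' ≤ (1 + ‖z‖) ^ (m' + m) := pow_le_pow_right₀ h1 (by omega)
    have h3 : (1 + ‖z‖) ^ m ≤ (1 + ‖z‖) ^ (m' + m) := pow_le_pow_right₀ h1 (by omega)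
    refine max_le ?_ ?_
    · calc _ ≤ C' * (1 + ‖z‖) ^ m' := h' z hz
        _ ≤ |C'| * (1 + ‖z‖) ^ (m' + m) := by gcongr; exact le_abs_self _
        _ ≤ _ := by gcongr; linarith
    · calc _ ≤ C * (1 + ‖z‖) ^ m := h z hz
        _ ≤ C * (1 + ‖z‖) ^ (m' + m) := by gcongr
        _ ≤ _ := by gcongr; linarith [abs_nonneg C']

theorem IsStripCurve.clm {v : ℂ → 𝓢(E, ℂ)} (hv : IsStripCurve v) (L : 𝓢(E, ℂ) →L[ℂ] 𝓢(F, ℂ)) :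
    IsStripCurve fun z => L (v z) where
  exists_slope z := by
    obtain ⟨v', h⟩ := hv.exists_slope z
    refine ⟨L v', ((L.continuous.tendsto v').comp h).congr fun y => ?_⟩
    simp [slope]
  growth k n := by
    obtain ⟨s, C, -, h⟩ := Seminorm.bound_of_continuous (schwartz_withSeminorms ℂ E ℂ)
      ((SchwartzMap.seminorm ℂ k n : Seminorm ℂ 𝓢(F, ℂ)).comp L.toLinearMap)
      (((schwartz_withSeminorms ℂ F ℂ).continuous_seminorm (k, n)).comp L.continuous)
    obtain ⟨C', m, hC', h'⟩ := hv.growth_sup s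
    refine ⟨C * C', m, fun z hz => ?_⟩
    have h1 := h (v z)
    calc _ ≤ C * s.sup (schwartzSeminormFamily ℂ E ℂ) (v z) := h1
      _ ≤ C * (C' * (1 + ‖z‖) ^ m) := by gcongr; exact h' z hz
      _ = _ := by ring

/-- A continuous bilinear map is bounded in terms of seminorms.  The bound uses positive majorants
`a` and `b` of the seminorms because these may vanish on nonzero functions. -/
theorem exists_seminorm_bilinear_le {T : 𝓢(E, ℂ) →ₗ[ℂ] 𝓢(E, ℂ) →ₗ[ℂ] 𝓢(F, ℂ)}
    (hT : Continuous fun p : 𝓢(E, ℂ) × 𝓢(E, ℂ) => T p.1 p.2) (k n : ℕ) :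
    ∃ (s t : Finset (ℕ × ℕ)) (C : ℝ), 0 ≤ C ∧ ∀ (f g : 𝓢(E, ℂ)) (a b : ℝ), 0 < a → 0 < b →
      s.sup (schwartzSeminormFamily ℂ E ℂ) f ≤ a → t.sup (schwartzSeminormFamily ℂ E ℂ) g ≤ b →
      SchwartzMap.seminorm ℂ k n (T f g) ≤ C * a * b := by
  obtain ⟨p, hp⟩ : ∃ p : Seminorm ℂ 𝓢(F, ℂ), p = SchwartzMap.seminorm ℂ k n := ⟨_, rfl⟩
  rw [← hp]
  have hc : Continuous fun q : 𝓢(E, ℂ) × 𝓢(E, ℂ) => p (T q.1 q.2) :=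
    hp ▸ ((schwartz_withSeminorms ℂ F ℂ).continuous_seminorm (k, n)).comp hT
  have h0 : {q : 𝓢(E, ℂ) × 𝓢(E, ℂ) | p (T q.1 q.2) < 1} ∈ 𝓝 ((0 : 𝓢(E, ℂ)), (0 : 𝓢(E, ℂ))) :=
    (isOpen_lt hc continuous_const).mem_nhds (by simp)
  rw [nhds_prod_eq, Filter.mem_prod_iff] at h0
  obtain ⟨U, hU, V, hV, hUV'⟩ := h0
  have hUV : ∀ x ∈ U, ∀ y ∈ V, p (T x y) < 1 := fun x hx y hy => hUV' (Set.mk_mem_prod hx hy)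
  obtain ⟨s, r, hr, hs⟩ := ((schwartz_withSeminorms ℂ E ℂ).mem_nhds_iff 0 U).1 hU
  obtain ⟨t, r', hr', ht⟩ := ((schwartz_withSeminorms ℂ E ℂ).mem_nhds_iff 0 V).1 hV
  refine ⟨s, t, (2 / r) * (2 / r'), by positivity, fun f g a b ha hb hf hg => ?_⟩
  obtain ⟨A, hA, hAa, hAi⟩ : ∃ A : ℝ, 0 < A ∧ A * a < r ∧ A⁻¹ = 2 / r * a := by
    refine ⟨r / (2 * a), by positivity, ?_, by field_simp⟩
    have : r / (2 * a) * a = r / 2 := by field_simp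
    linarith
  obtain ⟨B, hB, hBb, hBi⟩ : ∃ B : ℝ, 0 < B ∧ B * b < r' ∧ B⁻¹ = 2 / r' * b := by
    refine ⟨r' / (2 * b), by positivity, ?_, by field_simp⟩
    have : r' / (2 * b) * b = r' / 2 := by field_simp
    linarith
  have hfU : (A : ℂ) • f ∈ U := hs (by
    rw [Seminorm.mem_ball_zero, map_smul_eq_mul, Complex.norm_real, Real.norm_of_nonneg hA.le]
    exact (mul_le_mul_of_nonneg_left hf hA.le).trans_lt hAa)
  have hgV : (B : ℂ) • g ∈ V := ht (by
    rw [Seminorm.mem_ball_zero, map_smul_eq_mul, Complex.norm_real, Real.norm_of_nonneg hB.le]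
    exact (mul_le_mul_of_nonneg_left hg hB.le).trans_lt hBb)
  have h1 : p (T ((A : ℂ) • f) ((B : ℂ) • g)) < 1 := hUV _ hfU _ hgV
  have e1 : T ((A : ℂ) • f) ((B : ℂ) • g) = (A : ℂ) • (B : ℂ) • T f g := by
    rw [T.map_smul, LinearMap.smul_apply, (T f).map_smul]
  rw [e1, map_smul_eq_mul, map_smul_eq_mul,
    Complex.norm_real, Complex.norm_real, Real.norm_of_nonneg hA.le,
    Real.norm_of_nonneg hB.le] at h1
  have h2 : p (T f g) ≤ A⁻¹ * B⁻¹ := by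
    rw [← mul_inv, ← one_div, le_div_iff₀ (by positivity)]
    linarith
  refine h2.trans (le_of_eq ?_)
  rw [hAi, hBi]
  ring

theorem IsStripCurve.bilinear {T : 𝓢(E, ℂ) →ₗ[ℂ] 𝓢(E, ℂ) →ₗ[ℂ] 𝓢(F, ℂ)}
    (hT : Continuous fun p : 𝓢(E, ℂ) × 𝓢(E, ℂ) => T p.1 p.2) {v w : ℂ → 𝓢(E, ℂ)}
    (hv : IsStripCurve v) (hw : IsStripCurve w) : IsStripCurve fun z => T (v z) (w z) where
  exists_slope z := by
    obtain ⟨v', h⟩ := hv.exists_slope z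
    obtain ⟨w', h'⟩ := hw.exists_slope z
    have hv0 := tendsto_of_tendsto_slope h
    have h1 := (hT.tendsto (v', w z)).comp
      (h.prodMk_nhds (tendsto_of_tendsto_slope h'))
    have h2 := (hT.tendsto (v z, w')).comp
      ((tendsto_const_nhds (x := v z) (f := 𝓝[≠] z)).prodMk_nhds h')
    refine ⟨_, (h1.add h2).congr fun y => ?_⟩
    simp only [slope, comp_apply, vsub_eq_sub, map_smul, map_sub, LinearMap.smul_apply,
      LinearMap.sub_apply, ← smul_add]
    congr 1
    abel
  growth k n := by
    obtain ⟨s, t, C, hC, h⟩ := exists_seminorm_bilinear_le hT k n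
    obtain ⟨C₁, m₁, hC₁, h₁⟩ := hv.growth_sup s
    obtain ⟨C₂, m₂, hC₂, h₂⟩ := hw.growth_sup t
    refine ⟨C * (C₁ + 1) * (C₂ + 1), m₁ + m₂, fun z hz => ?_⟩
    have e₁ : C₁ * (1 + ‖z‖) ^ m₁ ≤ (C₁ + 1) * (1 + ‖z‖) ^ m₁ := by gcongr; linarith
    have e₂ : C₂ * (1 + ‖z‖) ^ m₂ ≤ (C₂ + 1) * (1 + ‖z‖) ^ m₂ := by gcongr; linarith
    refine (h (v z) (w z) _ _ ?_ ?_ ((h₁ z hz).trans e₁) ((h₂ z hz).trans e₂)).trans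
      (le_of_eq (by ring))
    all_goals positivity

/-- Joint continuity at `(z, 0)` of `(y, u) ↦ ⟨c x⟩ ^ (α + β y) u`, from equicontinuity. -/
theorem tendsto_bracketMul_of_tendsto (c : ℝ) (α β : ℝ) (z : ℂ) {f : Filter ℂ} (hf : f ≤ 𝓝 z)
    {v : ℂ → 𝓢(E, ℂ)} (hv : Tendsto v f (𝓝 0)) :
    Tendsto (fun y => bracketMul c (α + β * y) (v y)) f (𝓝 0) := by
  have hcont : Continuous fun y : ℂ => (α : ℂ) + β * y := by fun_prop
  refine ((schwartz_withSeminorms ℂ E ℂ).tendsto_nhds _ _).2 fun i ε hε => ?_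
  obtain ⟨R, hR⟩ := exists_nat_gt ‖(α : ℂ) + β * z‖
  obtain ⟨C, l, hC, h⟩ := exists_seminorm_bracketMul_le (E := E) c i.1 i.2 R
  have hev : ∀ᶠ y in f, ‖(α : ℂ) + β * y‖ < R :=
    hf ((hcont.norm.tendsto z).eventually_lt_const hR)
  have hK : 0 < C * (1 + R : ℝ) ^ i.2 + 1 := by positivity
  have hv' := ((schwartz_withSeminorms ℂ E ℂ).tendsto_nhds' v 0).1 hv
    (Finset.Iic (l, i.2)) (ε / (C * (1 + R : ℝ) ^ i.2 + 1)) (by positivity)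
  filter_upwards [hev, hv'] with y hy1 hy2
  rw [sub_zero] at hy2 ⊢
  rw [lt_div_iff₀ hK] at hy2
  set q := (Finset.Iic (l, i.2)).sup (schwartzSeminormFamily ℂ E ℂ) (v y)
  have hq : 0 ≤ q := apply_nonneg _ _
  calc _ ≤ C * (1 + ‖(α : ℂ) + β * y‖) ^ i.2 * q :=
        h _ ((Complex.re_le_norm _).trans hy1.le) (v y)
    _ ≤ C * (1 + R) ^ i.2 * q := by gcongr
    _ ≤ q * (C * (1 + R) ^ i.2 + 1) := by linarith
    _ < ε := hy2

/-- The curve `z ↦ ⟨c x⟩ ^ (α + β z) u` has derivative `β log ⟨c x⟩ ⟨c x⟩ ^ (α + β z) u`. -/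
theorem tendsto_slope_bracketMul (c : ℝ) (α β : ℝ) (z : ℂ) (u : 𝓢(E, ℂ)) :
    Tendsto (slope (fun y => bracketMul c (α + β * y) u) z) (𝓝[≠] z)
      (𝓝 ((β : ℂ) • bracketLogMul c (bracketMul c (α + β * z) u))) := by
  refine ((schwartz_withSeminorms ℂ E ℂ).tendsto_nhds _ _).2 fun i ε hε => ?_
  obtain ⟨C, l, hC, h⟩ := exists_seminorm_bracketMul_remainder_le (E := E) c i.1 i.2
  set u₀ := bracketMul c (α + β * z) u
  set q := (Finset.Iic (l, i.2)).sup (schwartzSeminormFamily ℂ E ℂ) u₀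
  have hq : 0 ≤ q := apply_nonneg _ _
  have ht : Tendsto (fun y : ℂ => ‖y - z‖) (𝓝[≠] z) (𝓝 0) := by
    have : Continuous fun y : ℂ => ‖y - z‖ := by fun_prop
    have := this.tendsto z
    rw [sub_self, norm_zero] at this
    exact this.mono_left nhdsWithin_le_nhds
  have h1 : ∀ᶠ y in 𝓝[≠] z, |β| * ‖y - z‖ < 1 :=
    (ht.const_mul |β|).eventually_lt_const (by simp)
  have h2 : ∀ᶠ y in 𝓝[≠] z, C * |β| ^ 2 * q * ‖y - z‖ < ε :=
    (ht.const_mul (C * |β| ^ 2 * q)).eventually_lt_const (by simpa using hε)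
  filter_upwards [h1, h2, self_mem_nhdsWithin] with y hy1 hy2 hyz
  have hyz' : y - z ≠ 0 := sub_ne_zero.2 hyz
  have hpos : 0 < ‖y - z‖ := norm_pos_iff.2 hyz'
  have hw : ‖(β : ℂ) * (y - z)‖ = |β| * ‖y - z‖ := by
    rw [norm_mul, Complex.norm_real, Real.norm_eq_abs]
  have e1 : bracketMul c (α + β * y) u = bracketMul c (β * (y - z)) u₀ := by
    rw [bracketMul_bracketMul]
    congr 2
    ring
  have e : slope (fun y => bracketMul c (α + β * y) u) z y - (β : ℂ) • bracketLogMul c u₀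
      = (y - z)⁻¹ • (bracketMul c (β * (y - z)) u₀ - u₀
        - ((β : ℂ) * (y - z)) • bracketLogMul c u₀) := by
    rw [slope, vsub_eq_sub, e1, smul_sub _ (_ - _), smul_smul]
    congr 2
    field_simp
  rw [e, map_smul_eq_mul, norm_inv]
  have h3 := h (β * (y - z)) (by rw [hw]; exact hy1.le) u₀
  rw [hw] at h3
  calc _ ≤ ‖y - z‖⁻¹ * (C * (|β| * ‖y - z‖) ^ 2 * q) := by gcongr; exact h3
    _ = C * |β| ^ 2 * q * ‖y - z‖ := by field_simp
    _ < ε := hy2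

/-- Real `α` and `β` keep `Re (α + β z)` bounded in the strip. -/
theorem IsStripCurve.bracketMul {v : ℂ → 𝓢(E, ℂ)} (hv : IsStripCurve v) (c α β : ℝ) :
    IsStripCurve fun z => bracketMul c (α + β * z) (v z) where
  exists_slope z := by
    obtain ⟨v', h⟩ := hv.exists_slope z
    have h1 := tendsto_slope_bracketMul c α β z (v z)
    have h2 := tendsto_of_tendsto_slope (tendsto_slope_bracketMul c α β z v')
    -- Product rule, with `⟨c x⟩ ^ (α + β y) (slope v z y)` split at the limit `v'` of the slopes.
    have h3 : Tendsto (fun y => slope v z y - v') (𝓝[≠] z) (𝓝 0) := by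
      simpa using h.sub_const v'
    have h4 := tendsto_bracketMul_of_tendsto c α β z nhdsWithin_le_nhds h3
    refine ⟨_, ((h4.add h2).add h1).congr fun y => ?_⟩
    simp only [slope, vsub_eq_sub, map_smul, map_sub, sub_add_cancel, ← smul_add]
    congr 1
    abel
  growth k n := by
    obtain ⟨R, hR⟩ := exists_nat_ge (|α| + |β|)
    obtain ⟨C, l, hC, h⟩ := exists_seminorm_bracketMul_le (E := E) c k n R
    obtain ⟨C', m, hC', h'⟩ := hv.growth_sup (Finset.Iic (l, n))
    refine ⟨C * (1 + |α| + |β|) ^ n * C', n + m, fun z hz => ?_⟩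
    have hre : ((α : ℂ) + β * z).re ≤ R := by
      have e : ((α : ℂ) + β * z).re = α + β * z.re := by simp
      have h1 : β * z.re ≤ |β| * 1 := by
        calc β * z.re ≤ |β * z.re| := le_abs_self _
          _ = |β| * |z.re| := abs_mul _ _
          _ ≤ _ := by gcongr
      rw [e]
      linarith [le_abs_self α]
    have hn : 1 + ‖(α : ℂ) + β * z‖ ≤ (1 + |α| + |β|) * (1 + ‖z‖) := by
      have h1 := norm_add_le (α : ℂ) (β * z)
      rw [norm_mul, Complex.norm_real, Complex.norm_real, Real.norm_eq_abs, Real.norm_eq_abs] at h1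
      nlinarith [norm_nonneg z, abs_nonneg α, abs_nonneg β,
        mul_nonneg (abs_nonneg α) (norm_nonneg z)]
    calc _ ≤ C * (1 + ‖(α : ℂ) + β * z‖) ^ n *
          (Finset.Iic (l, n)).sup (schwartzSeminormFamily ℂ E ℂ) (v z) := h _ hre _
      _ ≤ C * ((1 + |α| + |β|) * (1 + ‖z‖)) ^ n * (C' * (1 + ‖z‖) ^ m) := by
          gcongr
          exact h' z hz
      _ = _ := by rw [mul_pow, pow_add]; ring

end Curves

/-! ### The three lines theorem -/

section ThreeLines

variable {E : Type*} [NormedAddCommGroup E] [InnerProductSpace ℝ E]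
  [FiniteDimensional ℝ E] [MeasurableSpace E] [BorelSpace E]

theorem one_add_pow_le_exp {y : ℝ} (hy : 0 ≤ y) (m : ℕ) :
    (1 + y) ^ m ≤ m.factorial * Real.exp (1 + y) := by
  have := Real.pow_div_factorial_le_exp (1 + y) (by linarith) m
  rwa [div_le_iff₀' (by positivity)] at this

/-- Hadamard's three lines theorem for the `L²` norm along a curve in Schwartz space, with
polynomially growing boundary values.  The factor `exp (z²)` absorbs that growth. -/
theorem IsStripCurve.norm_toLp_le {v : ℂ → 𝓢(E, ℂ)} (hv : IsStripCurve v) {A : ℝ} {m : ℕ}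
    (h0 : ∀ z : ℂ, z.re = 0 → ‖(v z).toLp 2‖ ≤ A * (1 + |z.im|) ^ m)
    (h1 : ∀ z : ℂ, z.re = 1 → ‖(v z).toLp 2‖ ≤ A * (1 + |z.im|) ^ m)
    {θ : ℝ} (hθ0 : 0 ≤ θ) (hθ1 : θ ≤ 1) :
    ‖(v θ).toLp 2‖ ≤ m.factorial * Real.exp 3 * A := by
  have hA : 0 ≤ A := by
    simpa using (norm_nonneg ((v 0).toLp 2 (volume : Measure E))).trans (h0 0 (by simp))
  set G : ℂ → Lp ℂ 2 (volume : Measure E) := fun z =>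
    Complex.exp (z ^ 2) • (v z).toLp 2 volume with hG
  have hexp : ∀ z : ℂ, ‖Complex.exp (z ^ 2)‖ = Real.exp (z.re ^ 2 - z.im ^ 2) := by
    intro z
    rw [Complex.norm_exp]
    congr 1
    rw [sq z, Complex.mul_re]
    ring
  have hdiff : Differentiable ℂ G := by
    have hd : Differentiable ℂ fun z => (v z).toLp 2 (volume : Measure E) := by
      intro z
      obtain ⟨v', h⟩ := hv.exists_slope z
      have h2 := ((SchwartzMap.toLpCLM ℂ ℂ 2 (volume : Measure E)).continuous.tendsto v').comp h
      refine (hasDerivAt_iff_tendsto_slope.2 (h2.congr fun y => ?_)).differentiableAt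
      simp only [comp_apply, slope, vsub_eq_sub, map_smul, map_sub, SchwartzMap.toLpCLM_apply]
    have he : Differentiable ℂ fun z : ℂ => Complex.exp (z ^ 2) := by fun_prop
    exact he.smul hd
  have hgrowth : ∃ (C : ℝ) (k : ℕ), 0 ≤ C ∧ ∀ z : ℂ, |z.re| ≤ 1 →
      ‖(v z).toLp 2‖ ≤ C * (1 + ‖z‖) ^ k := by
    obtain ⟨s, C, -, h⟩ := Seminorm.bound_of_continuous (schwartz_withSeminorms ℂ E ℂ)
      ((normSeminorm ℂ (Lp ℂ 2 (volume : Measure E))).comp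
        (SchwartzMap.toLpCLM ℂ ℂ 2 (volume : Measure E)).toLinearMap)
      (continuous_norm.comp (SchwartzMap.toLpCLM ℂ ℂ 2 (volume : Measure E)).continuous)
    obtain ⟨C', k, hC', h'⟩ := hv.growth_sup s
    refine ⟨C * C', k, by positivity, fun z hz => ?_⟩
    calc _ ≤ C * s.sup (schwartzSeminormFamily ℂ E ℂ) (v z) := h (v z)
      _ ≤ C * (C' * (1 + ‖z‖) ^ k) := by gcongr; exact h' z hz
      _ = _ := by ring
  have hbd : ∀ z : ℂ, z.re ^ 2 ≤ 1 → ‖(v z).toLp 2‖ ≤ A * (1 + |z.im|) ^ m →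
      ‖G z‖ ≤ m.factorial * Real.exp 3 * A := by
    intro z hz hvz
    rw [hG, norm_smul, hexp]
    calc _ ≤ Real.exp (z.re ^ 2 - z.im ^ 2) *
          (A * (m.factorial * Real.exp (1 + |z.im|))) := by
          gcongr
          exact hvz.trans (by gcongr; exact one_add_pow_le_exp (abs_nonneg _) m)
      _ = m.factorial * A * Real.exp (z.re ^ 2 - z.im ^ 2 + (1 + |z.im|)) := by
          rw [Real.exp_add (z.re ^ 2 - z.im ^ 2)]; ring
      _ ≤ m.factorial * A * Real.exp 3 := by
          gcongr
          -- `x² - y² + 1 + |y| ≤ 2 + 1/4` when `x² ≤ 1`.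
          have := sq_abs z.im
          nlinarith [sq_nonneg (|z.im| - 1 / 2)]
      _ = _ := by ring
  have hmain : ‖G θ‖ ≤ m.factorial * Real.exp 3 * A := by
    refine PhragmenLindelof.vertical_strip (a := 0) (b := 1) hdiff.diffContOnCl ?_
      (fun z hz => hbd z (by rw [hz]; norm_num) (h0 z hz))
      (fun z hz => hbd z (by rw [hz]; norm_num) (h1 z hz)) (by simpa) (by simpa)
    obtain ⟨C, k, hC, hk⟩ := hgrowth
    -- Phragmén-Lindelöf allows growth `exp (exp |Im z|)`, far more than the polynomial one here.
    refine ⟨1, by simpa using by linarith [Real.pi_gt_three], 1, ?_⟩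
    refine Asymptotics.IsBigO.of_bound (Real.exp 1 * (C * (k.factorial * Real.exp 2))) ?_
    refine Filter.Eventually.filter_mono inf_le_right (Filter.eventually_principal.2 ?_)
    intro z hz
    have hz' : 0 < z.re ∧ z.re < 1 := hz
    have hre : |z.re| ≤ 1 := by rw [abs_of_pos hz'.1]; exact hz'.2.le
    have hn : ‖z‖ ≤ 1 + |z.im| := (Complex.norm_le_abs_re_add_abs_im z).trans (by linarith)
    have he : Real.exp (z.re ^ 2 - z.im ^ 2) ≤ Real.exp 1 :=
      Real.exp_le_exp.2 (by nlinarith [sq_nonneg z.im])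
    rw [hG, norm_smul, hexp, one_mul, one_mul, Real.norm_of_nonneg (Real.exp_nonneg _)]
    calc _ ≤ Real.exp 1 * (C * (1 + ‖z‖) ^ k) := by gcongr; exact hk z hre
      _ ≤ Real.exp 1 * (C * (k.factorial * Real.exp (1 + ‖z‖))) := by
          gcongr
          exact one_add_pow_le_exp (norm_nonneg z) k
      _ ≤ Real.exp 1 * (C * (k.factorial * Real.exp (2 + |z.im|))) := by
          gcongr Real.exp 1 * (C * (k.factorial * Real.exp ?_))
          linarith
      _ ≤ Real.exp 1 * (C * (k.factorial * (Real.exp 2 * Real.exp (Real.exp |z.im|)))) := by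
          rw [Real.exp_add]
          gcongr
          linarith [Real.add_one_le_exp |z.im|]
      _ = _ := by ring
  refine le_trans ?_ hmain
  rw [hG, norm_smul, hexp]
  have : 1 ≤ Real.exp ((θ : ℂ).re ^ 2 - (θ : ℂ).im ^ 2) := Real.one_le_exp (by simp; positivity)
  exact le_mul_of_one_le_left (norm_nonneg _) this

end ThreeLines

/-! ### The `L²` norm and Fourier multipliers -/

section FourierMultipliers

variable {E : Type*} [NormedAddCommGroup E] [InnerProductSpace ℝ E]
  [FiniteDimensional ℝ E] [MeasurableSpace E] [BorelSpace E]

/-- The `L²` norm as a seminorm on Schwartz space. -/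
def l2Seminorm : Seminorm ℂ 𝓢(E, ℂ) :=
  (normSeminorm ℂ (Lp ℂ 2 (volume : Measure E))).comp
    (SchwartzMap.toLpCLM ℂ ℂ 2 (volume : Measure E)).toLinearMap

theorem l2Seminorm_apply (u : 𝓢(E, ℂ)) : l2Seminorm u = ‖u.toLp 2 (volume : Measure E)‖ := rfl

theorem l2Seminorm_le_mul {u v : 𝓢(E, ℂ)} {K : ℝ} (h : ∀ x, ‖u x‖ ≤ K * ‖v x‖) :
    l2Seminorm u ≤ K * l2Seminorm v := by
  rw [l2Seminorm_apply, l2Seminorm_apply]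
  refine Lp.norm_le_mul_norm_of_ae_le_mul ?_
  filter_upwards [u.coeFn_toLp 2 volume, v.coeFn_toLp 2 volume] with x hu hv
  rw [hu, hv]
  exact h x

theorem l2Seminorm_congr {u v : 𝓢(E, ℂ)} (h : ∀ x, ‖u x‖ = ‖v x‖) :
    l2Seminorm u = l2Seminorm v :=
  le_antisymm (by simpa using l2Seminorm_le_mul (K := 1) fun x => by rw [one_mul, h x])
    (by simpa using l2Seminorm_le_mul (K := 1) fun x => by rw [one_mul, h x])

theorem l2Seminorm_smulLeftCLM_le {φ : E → ℂ} (hφ : φ.HasTemperateGrowth) {K : ℝ}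
    (h : ∀ x, ‖φ x‖ ≤ K) (u : 𝓢(E, ℂ)) :
    l2Seminorm (SchwartzMap.smulLeftCLM ℂ φ u) ≤ K * l2Seminorm u :=
  l2Seminorm_le_mul fun x => by
    rw [SchwartzMap.smulLeftCLM_apply_apply hφ, norm_smul]
    exact mul_le_mul_of_nonneg_right (h x) (norm_nonneg _)

theorem l2Seminorm_fourier (u : 𝓢(E, ℂ)) : l2Seminorm (𝓕 u) = l2Seminorm u :=
  SchwartzMap.norm_fourier_toL2_eq u

theorem l2Seminorm_fourierInv (u : 𝓢(E, ℂ)) : l2Seminorm (𝓕⁻ u) = l2Seminorm u := by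
  rw [← l2Seminorm_fourier, FourierTransform.fourier_fourierInv_eq]

/-- A complex power of the weight has the `L²` mapping properties of its real part. -/
theorem l2Seminorm_bracketMul_eq {c : ℝ} {z w : ℂ} (h : z.re = w.re) (u : 𝓢(E, ℂ)) :
    l2Seminorm (bracketMul c z u) = l2Seminorm (bracketMul c w u) :=
  l2Seminorm_congr fun x => by
    rw [bracketMul_apply, bracketMul_apply, norm_mul, norm_mul, norm_bracketPow, norm_bracketPow, h]

theorem l2Seminorm_bracketMul_of_re_eq_zero {c : ℝ} {z : ℂ} (h : z.re = 0) (u : 𝓢(E, ℂ)) :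
    l2Seminorm (bracketMul c z u) = l2Seminorm u := by
  rw [l2Seminorm_bracketMul_eq (w := 0) (by simpa using h), bracketMul_zero]

theorem l2Seminorm_bracketMul_mono {c : ℝ} {z w : ℂ} (h : z.re ≤ w.re) (u : 𝓢(E, ℂ)) :
    l2Seminorm (bracketMul c z u) ≤ l2Seminorm (bracketMul c w u) := by
  rw [← one_mul (l2Seminorm (bracketMul c w u))]
  refine l2Seminorm_le_mul fun x => ?_
  rw [bracketMul_apply, bracketMul_apply, norm_mul, norm_mul, norm_bracketPow, norm_bracketPow,
    one_mul]
  have := bracketLog_nonneg c x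
  gcongr

theorem l2Seminorm_fourierMultiplierCLM_le {m : E → ℂ} (hm : m.HasTemperateGrowth) {K : ℝ}
    (h : ∀ x, ‖m x‖ ≤ K) (u : 𝓢(E, ℂ)) :
    l2Seminorm (SchwartzMap.fourierMultiplierCLM ℂ m u) ≤ K * l2Seminorm u := by
  rw [SchwartzMap.fourierMultiplierCLM_apply, l2Seminorm_fourierInv, ← l2Seminorm_fourier u]
  exact l2Seminorm_smulLeftCLM_le hm h _

end FourierMultipliers

/-! ### Multiplication by coordinates -/

section Coordinates

variable {E : Type*} [NormedAddCommGroup E] [InnerProductSpace ℝ E]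

/-- Multiplication by the linear coordinate `x ↦ ⟪x, e⟫` on Schwartz space. -/
def coordMul (e : E) : 𝓢(E, ℂ) →L[ℝ] 𝓢(E, ℂ) :=
  SchwartzMap.smulLeftCLM ℂ fun x : E => (inner ℝ x e : ℝ)

theorem coordMul_apply (e : E) (u : 𝓢(E, ℂ)) (x : E) :
    coordMul e u x = (inner ℝ x e : ℝ) * u x := by
  rw [coordMul, SchwartzMap.smulLeftCLM_apply_apply (by fun_prop)]
  simp

theorem Function.HasTemperateGrowth.fderiv_apply {m : E → ℂ} (hm : m.HasTemperateGrowth) (e : E) :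
    (fun x => fderiv ℝ m x e).HasTemperateGrowth := by
  have hd : ContDiff ℝ (⊤ : ℕ∞) (fderiv ℝ m) := hm.1.fderiv_right (by simp)
  refine ⟨hd.clm_apply contDiff_const, fun n => ?_⟩
  obtain ⟨k, C, h⟩ := hm.2 (n + 1)
  refine ⟨k, ‖e‖ * C, fun x => ?_⟩
  calc _ ≤ ‖e‖ * ‖iteratedFDeriv ℝ n (fderiv ℝ m) x‖ :=
        norm_iteratedFDeriv_clm_apply_const (N := (⊤ : ℕ∞)) hd.contDiffAt (by exact_mod_cast le_top)
    _ ≤ ‖e‖ * (C * (1 + ‖x‖) ^ k) := by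
        rw [norm_iteratedFDeriv_fderiv]
        gcongr
        exact h x
    _ = _ := by ring

theorem abs_inner_le_exp_bracketLog {e : E} (he : ‖e‖ ≤ 1) (x : E) :
    |(inner ℝ x e : ℝ)| ≤ Real.exp (bracketLog 1 x) := by
  have h := exp_mul_bracketLog 1 1 x
  rw [one_mul, one_smul, ← Real.sqrt_eq_rpow] at h
  rw [h]
  have h1 : |(inner ℝ x e : ℝ)| ≤ ‖x‖ * ‖e‖ := abs_real_inner_le_norm x e
  exact (h1.trans (mul_le_of_le_one_right (norm_nonneg x) he)).trans
    (Real.le_sqrt_of_sq_le (by linarith))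

open LineDeriv in
theorem lineDeriv_smulLeftCLM {m : E → ℂ} (hm : m.HasTemperateGrowth) (e : E) (f : 𝓢(E, ℂ)) :
    ∂_{e} (SchwartzMap.smulLeftCLM ℂ m f)
      = SchwartzMap.smulLeftCLM ℂ (fun x => fderiv ℝ m x e) f
        + SchwartzMap.smulLeftCLM ℂ m (∂_{e} f) := by
  ext x
  rw [add_apply, SchwartzMap.smulLeftCLM_apply_apply (hm.fderiv_apply e),
    SchwartzMap.smulLeftCLM_apply_apply hm, SchwartzMap.lineDerivOp_apply_eq_fderiv,
    SchwartzMap.lineDerivOp_apply_eq_fderiv, SchwartzMap.smulLeftCLM_apply hm]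
  have hd : DifferentiableAt ℝ m x := hm.1.differentiable (by simp) x
  have : fderiv ℝ (fun y => m y • f y) x
      = m x • fderiv ℝ f x + (fderiv ℝ m x).smulRight (f x) :=
    (hd.hasFDerivAt.smul (f.hasFDerivAt x)).fderiv
  rw [this]
  simp
  ring

end Coordinates

/-! ### Fourier multipliers on weighted `L²` spaces -/

section WeightedMultipliers

variable {E : Type*} [NormedAddCommGroup E] [InnerProductSpace ℝ E]
  [FiniteDimensional ℝ E] [MeasurableSpace E] [BorelSpace E]

/-- The commutator of a coordinate with the Fourier multiplier of symbol `m` is a constant times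
the Fourier multiplier of symbol `∂ₑ m`. -/
theorem coordMul_fourierMultiplierCLM {m : E → ℂ} (hm : m.HasTemperateGrowth) (e : E)
    (u : 𝓢(E, ℂ)) :
    coordMul e (SchwartzMap.fourierMultiplierCLM ℂ m u)
      = SchwartzMap.fourierMultiplierCLM ℂ m (coordMul e u)
        - (2 * Real.pi * Complex.I)⁻¹ •
          SchwartzMap.fourierMultiplierCLM ℂ (fun x => fderiv ℝ m x e) u := by
  have hpi : (2 * Real.pi * Complex.I : ℂ) ≠ 0 := Complex.two_pi_I_ne_zero
  have h1 := SchwartzMap.fourierInv_lineDerivOp_eq (SchwartzMap.smulLeftCLM ℂ m (𝓕 u)) e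
  rw [lineDeriv_smulLeftCLM hm, SchwartzMap.lineDerivOp_fourier_eq] at h1
  have h2 : ∀ v : 𝓢(E, ℂ), SchwartzMap.smulLeftCLM ℂ (inner ℝ · e) v = coordMul e v :=
    fun _ => rfl
  rw [h2, h2, FourierTransform.fourierInv_add, FourierTransform.fourier_smul, map_smul,
    FourierTransform.fourierInv_smul, ← SchwartzMap.fourierMultiplierCLM_apply,
    ← SchwartzMap.fourierMultiplierCLM_apply, ← SchwartzMap.fourierMultiplierCLM_apply] at h1
  have h3 : coordMul e (SchwartzMap.fourierMultiplierCLM ℂ m u) = (2 * Real.pi * Complex.I)⁻¹ •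
      (2 * Real.pi * Complex.I) • coordMul e (SchwartzMap.fourierMultiplierCLM ℂ m u) := by
    rw [inv_smul_smul₀ hpi]
  rw [h3, ← neg_eq_iff_eq_neg.2 (h1.trans (neg_smul _ _)), smul_neg, smul_add, neg_smul, smul_neg,
    inv_smul_smul₀ hpi]
  abel

/-- One power of the weight, recovered from the coordinates: `⟨x⟩ = ⟨x⟩⁻¹ (1 + ∑ xⱼ²)`. -/
theorem l2Seminorm_bracketMul_add_one_le {ι : Type*} [Fintype ι] (b : OrthonormalBasis ι ℝ E)
    (z : ℂ) (v : 𝓢(E, ℂ)) :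
    l2Seminorm (bracketMul 1 (z + 1) v)
      ≤ l2Seminorm (bracketMul 1 z v) + ∑ j, l2Seminorm (bracketMul 1 z (coordMul (b j) v)) := by
  have hsum : bracketMul 1 (z + 1) v = bracketMul 1 (-1) (bracketMul 1 z v)
      + ∑ j, bracketMul 1 (-1) (coordMul (b j) (bracketMul 1 z (coordMul (b j) v))) := by
    ext x
    have e1 : (bracketPow 1 2 x : ℂ) = 1 + ∑ j, ((inner ℝ x (b j) : ℝ) : ℂ) ^ 2 := by
      have h := exp_mul_bracketLog 1 2 x
      rw [one_smul, div_self two_ne_zero, Real.rpow_one, ← b.sum_sq_inner_left] at h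
      rw [bracketPow]
      exact_mod_cast congrArg (fun r : ℝ => (r : ℂ)) h
    have e2 : (bracketPow 1 (z + 1) x : ℂ)
        = bracketPow 1 (-1) x * bracketPow 1 z x * bracketPow 1 2 x := by
      rw [← Pi.mul_apply, ← Pi.mul_apply, ← bracketPow_add, ← bracketPow_add]
      congr 1
      ring
    simp only [add_apply, sum_apply, bracketMul_apply, coordMul_apply]
    rw [e2, e1, mul_add, add_mul, mul_one, Finset.mul_sum, Finset.sum_mul]
    congr 1
    · ring
    · refine Finset.sum_congr rfl fun j _ => ?_
      ring
  have hle : ∀ j, l2Seminorm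
      (bracketMul 1 (-1) (coordMul (b j) (bracketMul 1 z (coordMul (b j) v))))
        ≤ l2Seminorm (bracketMul 1 z (coordMul (b j) v)) := by
    intro j
    rw [← one_mul (l2Seminorm (bracketMul 1 z (coordMul (b j) v)))]
    refine l2Seminorm_le_mul fun x => ?_
    rw [bracketMul_apply, coordMul_apply, ← mul_assoc, norm_mul]
    gcongr
    rw [norm_mul, norm_bracketPow, Complex.norm_real, Real.norm_eq_abs]
    calc _ ≤ Real.exp ((-1 : ℂ).re * bracketLog 1 x) * Real.exp (bracketLog 1 x) := by
          gcongr
          exact abs_inner_le_exp_bracketLog (b.norm_eq_one j).le x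
      _ = 1 := by rw [← Real.exp_add]; simp
  rw [hsum]
  refine (map_add_le_add _ _ _).trans (add_le_add ?_ ?_)
  · calc _ ≤ l2Seminorm (bracketMul 1 0 (bracketMul 1 z v)) :=
          l2Seminorm_bracketMul_mono (by simp) _
      _ = _ := by rw [bracketMul_zero]
  · refine (Finset.le_sum_of_subadditive _ (map_zero l2Seminorm).le
      (map_add_le_add _) _ _).trans ?_
    exact Finset.sum_le_sum fun j _ => hle j

/-- A coordinate is dominated by one power of the weight. -/
theorem l2Seminorm_bracketMul_coordMul_le {e : E} (he : ‖e‖ ≤ 1) (z : ℂ) (v : 𝓢(E, ℂ)) :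
    l2Seminorm (bracketMul 1 z (coordMul e v)) ≤ l2Seminorm (bracketMul 1 (z + 1) v) := by
  rw [← one_mul (l2Seminorm (bracketMul 1 (z + 1) v))]
  refine l2Seminorm_le_mul fun x => ?_
  rw [bracketMul_apply, coordMul_apply, bracketMul_apply, bracketPow_add, Pi.mul_apply, one_mul,
    norm_mul, norm_mul, norm_mul, norm_mul, mul_assoc, norm_bracketPow 1 1, Complex.norm_real,
    Real.norm_eq_abs, Complex.one_re, one_mul]
  gcongr
  exact abs_inner_le_exp_bracketLog he x

/-- Fourier multipliers whose symbol has `n` bounded derivatives are bounded on `L²` with weight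
`⟨x⟩ ^ n`. -/
theorem exists_l2Seminorm_bracketMul_fourierMultiplierCLM_le_nat (n : ℕ) :
    ∃ C : ℝ, 0 ≤ C ∧ ∀ (m : E → ℂ), m.HasTemperateGrowth → ∀ K : ℝ, 0 ≤ K →
      (∀ i ≤ n, ∀ x, ‖iteratedFDeriv ℝ i m x‖ ≤ K) → ∀ u : 𝓢(E, ℂ),
      l2Seminorm (bracketMul 1 n (SchwartzMap.fourierMultiplierCLM ℂ m u))
        ≤ C * K * l2Seminorm (bracketMul 1 n u) := by
  induction n with
  | zero =>
    refine ⟨1, zero_le_one, fun m hm K hK h u => ?_⟩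
    simp only [Nat.cast_zero, bracketMul_zero, one_mul]
    exact l2Seminorm_fourierMultiplierCLM_le hm (fun x => by simpa using h 0 le_rfl x) u
  | succ n ih =>
    obtain ⟨C, hC, ih⟩ := ih
    set b := stdOrthonormalBasis ℝ E
    refine ⟨C + ∑ _j : Fin (Module.finrank ℝ E), (C + C), by positivity, fun m hm K hK h u => ?_⟩
    set N := l2Seminorm (bracketMul 1 (n + 1 : ℂ) u) with hN
    have hN0 : 0 ≤ N := apply_nonneg _ _
    have hNn : l2Seminorm (bracketMul 1 (n : ℂ) u) ≤ N :=
      l2Seminorm_bracketMul_mono (by simp) u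
    have h1 := ih m hm K hK (fun i hi => h i (by omega)) u
    have h2 : ∀ j, l2Seminorm (bracketMul 1 (n : ℂ)
        (coordMul (b j) (SchwartzMap.fourierMultiplierCLM ℂ m u))) ≤ (C + C) * K * N := by
      intro j
      have hbj : ‖b j‖ ≤ 1 := (b.norm_eq_one j).le
      rw [coordMul_fourierMultiplierCLM hm, map_sub, map_smul]
      have h3 := ih m hm K hK (fun i hi => h i (by omega)) (coordMul (b j) u)
      have h4 := ih _ (hm.fderiv_apply (b j)) K hK (fun i hi x => by
        have hd : ContDiff ℝ (⊤ : ℕ∞) (fderiv ℝ m) := hm.1.fderiv_right (by simp)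
        calc _ ≤ ‖b j‖ * ‖iteratedFDeriv ℝ i (fderiv ℝ m) x‖ :=
              norm_iteratedFDeriv_clm_apply_const (N := (⊤ : ℕ∞)) hd.contDiffAt
                (by exact_mod_cast le_top)
          _ ≤ 1 * K := by
              rw [norm_iteratedFDeriv_fderiv]
              gcongr
              exact h (i + 1) (by omega) x
          _ = K := one_mul K) u
      have h5 := l2Seminorm_bracketMul_coordMul_le hbj (n : ℂ) u
      have hpi : ‖(2 * Real.pi * Complex.I : ℂ)⁻¹‖ ≤ 1 := by
        rw [norm_inv]
        apply inv_le_one_of_one_le₀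
        simp [abs_of_pos Real.pi_pos]
        linarith [Real.pi_gt_three]
      calc _ ≤ _ := map_sub_le_add _ _ _
        _ ≤ C * K * N + 1 * (C * K * N) := by
            rw [map_smul_eq_mul]
            gcongr
            · exact h3.trans (by gcongr)
            · exact h4.trans (by gcongr)
        _ = _ := by ring
    push_cast
    calc _ ≤ _ := l2Seminorm_bracketMul_add_one_le b (n : ℂ) _
      _ ≤ C * K * N + ∑ _j : Fin (Module.finrank ℝ E), (C + C) * K * N := by
          gcongr with j
          · exact h1.trans (by gcongr)
          · exact h2 j
      _ = _ := by simp only [Finset.sum_const, nsmul_eq_mul]; ring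

/-- Weights `⟨x⟩ ^ a` with `0 ≤ a ≤ n`, by interpolation between `⟨x⟩ ^ 0` and `⟨x⟩ ^ n`. -/
theorem exists_l2Seminorm_bracketMul_fourierMultiplierCLM_le_of_nonneg {a : ℝ} (ha : 0 ≤ a) :
    ∃ (C : ℝ) (n : ℕ), 0 ≤ C ∧ ∀ (m : E → ℂ), m.HasTemperateGrowth → ∀ K : ℝ, 0 ≤ K →
      (∀ i ≤ n, ∀ x, ‖iteratedFDeriv ℝ i m x‖ ≤ K) → ∀ u : 𝓢(E, ℂ),
      l2Seminorm (bracketMul 1 a (SchwartzMap.fourierMultiplierCLM ℂ m u))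
        ≤ C * K * l2Seminorm (bracketMul 1 a u) := by
  obtain ⟨n, hn⟩ := exists_nat_gt a
  have hn0 : (0 : ℝ) < n := ha.trans_lt hn
  obtain ⟨C, hC, h⟩ := exists_l2Seminorm_bracketMul_fourierMultiplierCLM_le_nat (E := E) n
  refine ⟨Real.exp 3 * (1 + C), n, by positivity, fun m hm K hK hmK u₀ => ?_⟩
  -- The curve `⟨x⟩ ^ (n z) m(D) ⟨x⟩ ^ (-n z) u` is evaluated at `z = a / n`.
  set u := bracketMul 1 a u₀ with hu
  set v : ℂ → 𝓢(E, ℂ) := fun z => bracketMul 1 ((0 : ℝ) + (n : ℝ) * z)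
    (SchwartzMap.fourierMultiplierCLM ℂ m (bracketMul 1 ((0 : ℝ) + (-n : ℝ) * z) u)) with hv
  have hcurve : IsStripCurve v := by
    have h1 := (isStripCurve_const u).bracketMul 1 0 (-n)
    have h2 := (h1.clm (SchwartzMap.fourierMultiplierCLM ℂ m)).bracketMul 1 0 n
    convert h2 using 4
  have hu0 : 0 ≤ l2Seminorm u := apply_nonneg _ _
  have h0 : ∀ z : ℂ, z.re = 0 → ‖(v z).toLp 2‖ ≤ (1 + C) * K * l2Seminorm u * (1 + |z.im|) ^ 0 := by
    intro z hz
    rw [← l2Seminorm_apply, hv, pow_zero, mul_one,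
      l2Seminorm_bracketMul_of_re_eq_zero (by simp [hz])]
    refine (l2Seminorm_fourierMultiplierCLM_le hm
      (fun x => by simpa using hmK 0 (Nat.zero_le n) x) _).trans ?_
    rw [l2Seminorm_bracketMul_of_re_eq_zero (by simp [hz])]
    gcongr
    nlinarith
  have h1 : ∀ z : ℂ, z.re = 1 → ‖(v z).toLp 2‖ ≤ (1 + C) * K * l2Seminorm u * (1 + |z.im|) ^ 0 := by
    intro z hz
    rw [← l2Seminorm_apply, hv, pow_zero, mul_one,
      l2Seminorm_bracketMul_eq (w := n) (by simp [hz])]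
    refine (h m hm K hK hmK _).trans ?_
    rw [bracketMul_bracketMul, l2Seminorm_bracketMul_of_re_eq_zero (by simp [hz])]
    gcongr
    linarith
  have hθ := hcurve.norm_toLp_le h0 h1 (θ := a / n) (by positivity)
    ((div_le_one hn0).2 hn.le)
  have e1 : ((0 : ℝ) : ℂ) + ((n : ℝ) : ℂ) * ((a / n : ℝ) : ℂ) = a := by
    rw [← Complex.ofReal_mul, ← Complex.ofReal_add]
    congr 1
    field_simp
    simp
  have e2 : ((0 : ℝ) : ℂ) + ((-n : ℝ) : ℂ) * ((a / n : ℝ) : ℂ) = -a := by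
    rw [← Complex.ofReal_mul, ← Complex.ofReal_add, ← Complex.ofReal_neg]
    congr 1
    field_simp
    simp
  have e3 : v ((a / n : ℝ) : ℂ) = bracketMul 1 a (SchwartzMap.fourierMultiplierCLM ℂ m u₀) := by
    simp only [hv]
    rw [e1, e2, hu, bracketMul_bracketMul, neg_add_cancel, bracketMul_zero]
  rw [e3, ← l2Seminorm_apply] at hθ
  refine hθ.trans (le_of_eq ?_)
  rw [Nat.factorial_zero]
  push_cast
  ring

theorem inner_toLp_smulLeftCLM {φ ψ : E → ℂ} (hφ : φ.HasTemperateGrowth)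
    (hψ : ψ.HasTemperateGrowth) (h : ∀ x, ψ x = starRingEnd ℂ (φ x)) (u v : 𝓢(E, ℂ)) :
    inner ℂ ((SchwartzMap.smulLeftCLM ℂ φ u).toLp 2 (volume : Measure E)) (v.toLp 2)
      = inner ℂ (u.toLp 2 (volume : Measure E)) ((SchwartzMap.smulLeftCLM ℂ ψ v).toLp 2) := by
  rw [SchwartzMap.inner_toL2_toL2_eq _ _ volume, SchwartzMap.inner_toL2_toL2_eq _ _ volume]
  congr 1
  ext x
  rw [SchwartzMap.smulLeftCLM_apply_apply hφ, SchwartzMap.smulLeftCLM_apply_apply hψ, h]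
  simp
  ring

/-- The adjoint of a Fourier multiplier has the conjugate symbol. -/
theorem inner_toLp_fourierMultiplierCLM {φ ψ : E → ℂ} (hφ : φ.HasTemperateGrowth)
    (hψ : ψ.HasTemperateGrowth) (h : ∀ x, ψ x = starRingEnd ℂ (φ x)) (u v : 𝓢(E, ℂ)) :
    inner ℂ ((SchwartzMap.fourierMultiplierCLM ℂ φ u).toLp 2 (volume : Measure E)) (v.toLp 2)
      = inner ℂ (u.toLp 2 (volume : Measure E))
        ((SchwartzMap.fourierMultiplierCLM ℂ ψ v).toLp 2) := by
  rw [← SchwartzMap.inner_fourier_toL2_eq, ← SchwartzMap.inner_fourier_toL2_eq u,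
    SchwartzMap.fourierMultiplierCLM_apply, SchwartzMap.fourierMultiplierCLM_apply,
    FourierTransform.fourier_fourierInv_eq, FourierTransform.fourier_fourierInv_eq]
  exact inner_toLp_smulLeftCLM hφ hψ h _ _

/-- Weighted `L²` boundedness of Fourier multipliers with all derivatives bounded, for every real
power of the weight; negative powers follow from positive ones by duality. -/
theorem exists_l2Seminorm_bracketMul_fourierMultiplierCLM_le (a : ℝ) :
    ∃ (C : ℝ) (n : ℕ), 0 ≤ C ∧ ∀ (m : E → ℂ), m.HasTemperateGrowth → ∀ K : ℝ, 0 ≤ K →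
      (∀ i ≤ n, ∀ x, ‖iteratedFDeriv ℝ i m x‖ ≤ K) → ∀ u : 𝓢(E, ℂ),
      l2Seminorm (bracketMul 1 a (SchwartzMap.fourierMultiplierCLM ℂ m u))
        ≤ C * K * l2Seminorm (bracketMul 1 a u) := by
  rcases le_total 0 a with ha | ha
  · exact exists_l2Seminorm_bracketMul_fourierMultiplierCLM_le_of_nonneg ha
  obtain ⟨C, n, hC, h⟩ := exists_l2Seminorm_bracketMul_fourierMultiplierCLM_le_of_nonneg (E := E)
    (neg_nonneg.2 ha)
  refine ⟨C, n, hC, fun m hm K hK hmK u => ?_⟩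
  set m' : E → ℂ := Complex.conjLIE ∘ m with hm'
  have hm't : m'.HasTemperateGrowth :=
    (Complex.conjLIE.toContinuousLinearEquiv.toContinuousLinearMap.hasTemperateGrowth).comp hm
  have hm'K : ∀ i ≤ n, ∀ x, ‖iteratedFDeriv ℝ i m' x‖ ≤ K := fun i hi x => by
    rw [hm', LinearIsometryEquiv.norm_iteratedFDeriv_comp_left]
    exact hmK i hi x
  have hreal : ∀ (s : ℝ) (x : E),
      bracketPow 1 (s : ℂ) x = starRingEnd ℂ (bracketPow 1 (s : ℂ) x) := by
    intro s x
    rw [bracketPow, ← Complex.ofReal_mul, ← Complex.ofReal_exp, Complex.conj_ofReal]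
  have hadj : ∀ (s : ℝ) (f g : 𝓢(E, ℂ)),
      inner ℂ ((bracketMul 1 (s : ℂ) f).toLp 2 (volume : Measure E)) (g.toLp 2)
        = inner ℂ (f.toLp 2 (volume : Measure E)) ((bracketMul 1 (s : ℂ) g).toLp 2) :=
    fun s f g => inner_toLp_smulLeftCLM (hasTemperateGrowth_bracketPow 1 _)
      (hasTemperateGrowth_bracketPow 1 _) (hreal s) f g
  -- With `y = ⟨x⟩ ^ a m(D) u`, moving all operators of one factor to the other in `⟪y, y⟫` leaves
  -- `⟪⟨x⟩ ^ a u, ⟨x⟩ ^ (-a) m̄(D) ⟨x⟩ ^ a y⟫`, where the power outside `m̄(D)` is nonnegative.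
  set y := bracketMul 1 (a : ℂ) (SchwartzMap.fourierMultiplierCLM ℂ m u) with hy
  set w := SchwartzMap.fourierMultiplierCLM ℂ m' (bracketMul 1 (a : ℂ) y) with hw
  have e1 : u = bracketMul 1 ((-a : ℝ) : ℂ) (bracketMul 1 (a : ℂ) u) := by
    rw [bracketMul_bracketMul, Complex.ofReal_neg, neg_add_cancel, bracketMul_zero]
  have e2 : inner ℂ (y.toLp 2 (volume : Measure E)) (y.toLp 2)
      = inner ℂ ((bracketMul 1 (a : ℂ) u).toLp 2 (volume : Measure E))
        ((bracketMul 1 ((-a : ℝ) : ℂ) w).toLp 2) := by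
    rw [← hadj (-a), ← e1]
    exact (hadj a _ y).trans (inner_toLp_fourierMultiplierCLM hm hm't (fun x => rfl) u _)
  have h1 : l2Seminorm (bracketMul 1 ((-a : ℝ) : ℂ) w) ≤ C * K * l2Seminorm y := by
    refine (h m' hm't K hK hm'K _).trans (le_of_eq ?_)
    rw [bracketMul_bracketMul, Complex.ofReal_neg, neg_add_cancel, bracketMul_zero]
  have h2 : l2Seminorm y * l2Seminorm y
      ≤ l2Seminorm (bracketMul 1 (a : ℂ) u) * (C * K * l2Seminorm y) := by
    calc l2Seminorm y * l2Seminorm y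
        = ‖inner ℂ (y.toLp 2 (volume : Measure E)) (y.toLp 2)‖ := by
          rw [inner_self_eq_norm_sq_to_K, l2Seminorm_apply]
          simp [sq]
      _ ≤ l2Seminorm (bracketMul 1 (a : ℂ) u) * l2Seminorm (bracketMul 1 ((-a : ℝ) : ℂ) w) := by
          rw [e2]
          exact norm_inner_le_norm _ _
      _ ≤ _ := by gcongr
  rcases (apply_nonneg l2Seminorm y).eq_or_lt with h0 | hpos
  · rw [← h0]
    have : 0 ≤ l2Seminorm (bracketMul 1 (a : ℂ) u) := apply_nonneg _ _
    positivity
  · refine le_of_mul_le_mul_right (h2.trans (le_of_eq ?_)) hpos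
    ring

/-- The complex power `⟨D⟩ ^ z`.  Its symbol is `⟨2 π ξ⟩ ^ z` since the Fourier transform has the
kernel `exp (-2 π i x · ξ)`. -/
def besselMul (z : ℂ) : 𝓢(E, ℂ) →L[ℂ] 𝓢(E, ℂ) :=
  SchwartzMap.fourierMultiplierCLM ℂ (bracketPow (2 * Real.pi) z)

theorem besselMul_eq (z : ℂ) (u : 𝓢(E, ℂ)) :
    besselMul z u = 𝓕⁻ (bracketMul (2 * Real.pi) z (𝓕 u)) := rfl

theorem besselMul_besselMul (z w : ℂ) (u : 𝓢(E, ℂ)) :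
    besselMul z (besselMul w u) = besselMul (z + w) u := by
  rw [besselMul_eq, besselMul_eq, FourierTransform.fourier_fourierInv_eq, bracketMul_bracketMul,
    besselMul_eq]

@[simp]
theorem besselMul_zero (u : 𝓢(E, ℂ)) : besselMul 0 u = u := by
  rw [besselMul_eq, bracketMul_zero, FourierTransform.fourierInv_fourier_eq]

theorem IsStripCurve.besselMul {v : ℂ → 𝓢(E, ℂ)} (hv : IsStripCurve v) (α β : ℝ) :
    IsStripCurve fun z => besselMul (α + β * z) (v z) :=
  ((hv.clm (FourierTransform.fourierCLM ℂ 𝓢(E, ℂ))).bracketMul (2 * Real.pi) α β).clm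
    (FourierTransform.fourierInvCLM ℂ 𝓢(E, ℂ))

/-- The imaginary powers of `⟨D⟩` are bounded on every weighted `L²` space, with polynomial
growth of the operator norm. -/
theorem exists_l2Seminorm_bracketMul_besselMul_le (a : ℝ) :
    ∃ (C : ℝ) (n : ℕ), 0 ≤ C ∧ ∀ z : ℂ, z.re = 0 → ∀ u : 𝓢(E, ℂ),
      l2Seminorm (bracketMul 1 a (besselMul z u))
        ≤ C * (1 + |z.im|) ^ n * l2Seminorm (bracketMul 1 a u) := by
  obtain ⟨C, n, hC, h⟩ := exists_l2Seminorm_bracketMul_fourierMultiplierCLM_le (E := E) a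
  obtain ⟨A, hA, h'⟩ := exists_norm_iteratedFDeriv_bracketPow_le (E := E) (2 * Real.pi) n
  refine ⟨C * A, n, by positivity, fun z hz u => ?_⟩
  have hzn : ‖z‖ = |z.im| := by
    have : z = z.im * Complex.I := by
      apply Complex.ext <;> simp [hz]
    rw [this]
    simp
  refine (h _ (hasTemperateGrowth_bracketPow _ z) (A * (1 + |z.im|) ^ n) (by positivity)
    (fun i hi x => ?_) u).trans (le_of_eq (by ring))
  have := h' z x i hi
  rwa [hz, zero_mul, Real.exp_zero, mul_one, hzn] at this

end WeightedMultipliers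

/-! ### Bilinear maps at complex exponents -/

section SobolevNorms

/-- The norm `‖u‖_(a,b)` in terms of the complex powers. -/
theorem weightedSobolevNorm_eq (d : ℕ) (a b : ℝ) (u : 𝓢(EuclideanSpace ℝ (Fin d), ℂ)) :
    weightedSobolevNorm d a b u = l2Seminorm (bracketMul 1 a (besselMul b u)) := by
  have h : ∀ (c s : ℝ) (x : EuclideanSpace ℝ (Fin d)),
      bracketPow c (s : ℂ) x = (((1 + ‖c • x‖ ^ 2) ^ (s / 2) : ℝ) : ℂ) := by
    intro c s x
    rw [bracketPow, ← exp_mul_bracketLog]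
    push_cast
    rfl
  have h1 : japaneseWeight d a = bracketPow 1 (a : ℂ) := by
    ext x
    rw [h, one_smul]
    rfl
  have h2 : japaneseSymbol d b = bracketPow (2 * Real.pi) (b : ℂ) := by
    ext x
    rw [h]
    rfl
  rw [weightedSobolevNorm, weightOp, besselOp, h1, h2, l2Seminorm_apply, bracketMul, besselMul]

variable {d : ℕ}

/-- With real parts of the exponents equal to `a` and `b`, the operator
`⟨D⟩ ^ (-w) ⟨x⟩ ^ (-z)` maps `L²` to the space with norm `‖·‖_(a,b)`, with polynomial growth in
the imaginary part of `w`. -/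
theorem exists_weightedSobolevNorm_besselMul_bracketMul_le (a b : ℝ) :
    ∃ (C : ℝ) (n : ℕ), 0 ≤ C ∧ ∀ z w : ℂ, z.re = a → w.re = b →
      ∀ f : 𝓢(EuclideanSpace ℝ (Fin d), ℂ),
      weightedSobolevNorm d a b (besselMul (-w) (bracketMul 1 (-z) f))
        ≤ C * (1 + |w.im|) ^ n * l2Seminorm f := by
  obtain ⟨C, n, hC, h⟩ := exists_l2Seminorm_bracketMul_besselMul_le
    (E := EuclideanSpace ℝ (Fin d)) a
  refine ⟨C, n, hC, fun z w hz hw f => ?_⟩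
  rw [weightedSobolevNorm_eq, besselMul_besselMul]
  refine (h (b + -w) (by simp [hw]) _).trans (le_of_eq ?_)
  rw [bracketMul_bracketMul, l2Seminorm_bracketMul_of_re_eq_zero (by simp [hz])]
  simp

/-- With real parts of the exponents equal to `a` and `b`, the `L²` norm of `⟨x⟩ ^ z ⟨D⟩ ^ w u` is
controlled by `‖u‖_(a,b)`, with polynomial growth in the imaginary part of `w`. -/
theorem exists_l2Seminorm_bracketMul_besselMul_le_weightedSobolevNorm (a b : ℝ) :
    ∃ (C : ℝ) (n : ℕ), 0 ≤ C ∧ ∀ z w : ℂ, z.re = a → w.re = b →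
      ∀ u : 𝓢(EuclideanSpace ℝ (Fin d), ℂ),
      l2Seminorm (bracketMul 1 z (besselMul w u))
        ≤ C * (1 + |w.im|) ^ n * weightedSobolevNorm d a b u := by
  obtain ⟨C, n, hC, h⟩ := exists_l2Seminorm_bracketMul_besselMul_le
    (E := EuclideanSpace ℝ (Fin d)) a
  refine ⟨C, n, hC, fun z w hz hw u => ?_⟩
  have e : besselMul w u = besselMul (w - b) (besselMul b u) := by
    rw [besselMul_besselMul, sub_add_cancel]
  rw [l2Seminorm_bracketMul_eq (w := a) (by simp [hz]), e, weightedSobolevNorm_eq]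
  refine (h (w - b) (by simp [hw]) _).trans (le_of_eq ?_)
  simp

theorem weightedSobolevNorm_nonneg (a b : ℝ) (u : 𝓢(EuclideanSpace ℝ (Fin d), ℂ)) :
    0 ≤ weightedSobolevNorm d a b u := norm_nonneg _

variable {N : ℕ}
  {T : 𝓢(EuclideanSpace ℝ (Fin d), ℂ) →ₗ[ℂ] 𝓢(EuclideanSpace ℝ (Fin d), ℂ) →ₗ[ℂ]
      𝓢(EuclideanSpace ℝ (Fin N), ℂ)}

/-- The bilinear map `T` conjugated by complex powers so that a bound by the norms with exponents
`ζ` becomes a bound from `L² × L²` to `L²`. -/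
def conjugatedBilinear
    (T : 𝓢(EuclideanSpace ℝ (Fin d), ℂ) →ₗ[ℂ] 𝓢(EuclideanSpace ℝ (Fin d), ℂ) →ₗ[ℂ]
      𝓢(EuclideanSpace ℝ (Fin N), ℂ)) (f g : 𝓢(EuclideanSpace ℝ (Fin d), ℂ)) (ζ : Fin 6 → ℂ) :
    𝓢(EuclideanSpace ℝ (Fin N), ℂ) :=
  bracketMul 1 (ζ 4) (besselMul (ζ 5)
    (T (besselMul (-ζ 1) (bracketMul 1 (-ζ 0) f)) (besselMul (-ζ 3) (bracketMul 1 (-ζ 2) g))))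

/-- Boundedness of `T` at the real exponents `σ` gives a bound, of polynomial growth, at all complex
exponents with real part `σ`. -/
theorem exists_l2Seminorm_conjugatedBilinear_le {σ : Fin 6 → ℝ}
    (hσ : σ ∈ boundednessExponents T) :
    ∃ (C : ℝ) (n : ℕ), 0 ≤ C ∧ ∀ (ζ : Fin 6 → ℂ) (Y : ℝ), (∀ i, (ζ i).re = σ i) →
      (∀ i, |(ζ i).im| ≤ Y) → ∀ f g,
      l2Seminorm (conjugatedBilinear T f g ζ)
        ≤ C * (1 + Y) ^ n * (l2Seminorm f * l2Seminorm g) := by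
  obtain ⟨C₀, h₀⟩ := hσ
  obtain ⟨C₁, n₁, hC₁, h₁⟩ :=
    exists_weightedSobolevNorm_besselMul_bracketMul_le (d := d) (σ 0) (σ 1)
  obtain ⟨C₂, n₂, hC₂, h₂⟩ :=
    exists_weightedSobolevNorm_besselMul_bracketMul_le (d := d) (σ 2) (σ 3)
  obtain ⟨C₃, n₃, hC₃, h₃⟩ :=
    exists_l2Seminorm_bracketMul_besselMul_le_weightedSobolevNorm (d := N) (σ 4) (σ 5)
  refine ⟨C₃ * |C₀| * C₁ * C₂, n₃ + n₁ + n₂, by positivity, fun ζ Y hre him f g => ?_⟩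
  have hY : 0 ≤ Y := (abs_nonneg _).trans (him 0)
  set F := besselMul (-ζ 1) (bracketMul 1 (-ζ 0) f)
  set G := besselMul (-ζ 3) (bracketMul 1 (-ζ 2) g)
  have hf : 0 ≤ l2Seminorm f := apply_nonneg _ _
  have hg : 0 ≤ l2Seminorm g := apply_nonneg _ _
  have hF : weightedSobolevNorm d (σ 0) (σ 1) F ≤ C₁ * (1 + Y) ^ n₁ * l2Seminorm f :=
    (h₁ _ _ (hre 0) (hre 1) f).trans (by gcongr; exact him 1)
  have hG : weightedSobolevNorm d (σ 2) (σ 3) G ≤ C₂ * (1 + Y) ^ n₂ * l2Seminorm g :=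
    (h₂ _ _ (hre 2) (hre 3) g).trans (by gcongr; exact him 3)
  have hF0 := weightedSobolevNorm_nonneg (σ 0) (σ 1) F
  have hG0 := weightedSobolevNorm_nonneg (σ 2) (σ 3) G
  have hT0 := weightedSobolevNorm_nonneg (σ 4) (σ 5) (T F G)
  calc l2Seminorm (conjugatedBilinear T f g ζ)
      ≤ C₃ * (1 + |(ζ 5).im|) ^ n₃ * weightedSobolevNorm N (σ 4) (σ 5) (T F G) :=
        h₃ _ _ (hre 4) (hre 5) _
    _ ≤ C₃ * (1 + Y) ^ n₃ * (|C₀| * (C₁ * (1 + Y) ^ n₁ * l2Seminorm f)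
          * (C₂ * (1 + Y) ^ n₂ * l2Seminorm g)) := by
        gcongr
        · exact him 5
        · refine (h₀ F G).trans ?_
          gcongr
          exact le_abs_self _
    _ = _ := by rw [pow_add, pow_add]; ring

theorem isStripCurve_conjugatedBilinear
    (hT : Continuous fun p : 𝓢(EuclideanSpace ℝ (Fin d), ℂ) × 𝓢(EuclideanSpace ℝ (Fin d), ℂ) =>
      T p.1 p.2) (f g : 𝓢(EuclideanSpace ℝ (Fin d), ℂ)) (α β : Fin 6 → ℝ) :
    IsStripCurve fun z : ℂ => conjugatedBilinear T f g fun i => α i + β i * z := by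
  have hin : ∀ (i j : Fin 6) (f : 𝓢(EuclideanSpace ℝ (Fin d), ℂ)),
      IsStripCurve fun z : ℂ =>
        besselMul (-(α j + β j * z)) (bracketMul 1 (-(α i + β i * z)) f) := by
    intro i j f
    have h := ((isStripCurve_const f).bracketMul 1 (-α i) (-β i)).besselMul (-α j) (-β j)
    have e : ∀ (i : Fin 6) (z : ℂ), ((-α i : ℝ) : ℂ) + ((-β i : ℝ) : ℂ) * z = -(α i + β i * z) := by
      intro i z
      push_cast
      ring
    simpa only [e] using h
  exact ((((hin 0 1 f).bilinear hT (hin 2 3 g)).besselMul (α 5) (β 5))).bracketMul 1 (α 4) (β 4)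

end SobolevNorms

end

end

/-! ### Interpolation -/

theorem theorem2 (d N : ℕ)
    (T : 𝓢(EuclideanSpace ℝ (Fin d), ℂ) →ₗ[ℂ] 𝓢(EuclideanSpace ℝ (Fin d), ℂ) →ₗ[ℂ]
      𝓢(EuclideanSpace ℝ (Fin N), ℂ))
    (hT : Continuous fun p : 𝓢(EuclideanSpace ℝ (Fin d), ℂ) × 𝓢(EuclideanSpace ℝ (Fin d), ℂ) =>
      T p.1 p.2) :
    Convex ℝ (boundednessExponents T) := by
  intro σ hσ τ hτ s t hs ht hst
  obtain ⟨C₀, n₀, hC₀, h₀⟩ := exists_l2Seminorm_conjugatedBilinear_le hσ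
  obtain ⟨C₁, n₁, hC₁, h₁⟩ := exists_l2Seminorm_conjugatedBilinear_le hτ
  set B : ℝ := ∑ i, |τ i - σ i|
  have hB : 0 ≤ B := Finset.sum_nonneg fun _ _ => abs_nonneg _
  set K : ℝ := (C₀ + C₁) * (1 + B) ^ (n₀ + n₁)
  set ζ : ℂ → Fin 6 → ℂ := fun z i => (σ i : ℂ) + ((τ i - σ i : ℝ) : ℂ) * z with hζ
  -- The constant of the three lines theorem for boundary values `K (1 + |Im z|) ^ (n₀ + n₁)`.
  refine ⟨(n₀ + n₁).factorial * Real.exp 3 * K, fun f₀ g₀ => ?_⟩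
  -- The exponents at the intermediate point, which is the parameter value `z = t`.
  set ρ : Fin 6 → ℝ := s • σ + t • τ with hρ
  have hζt : ζ t = fun i => (ρ i : ℂ) := by
    ext i
    have : s = 1 - t := by linarith
    simp only [hζ, hρ, Pi.add_apply, Pi.smul_apply, smul_eq_mul, this]
    push_cast
    ring
  set f := bracketMul 1 (ρ 0 : ℂ) (besselMul (ρ 1 : ℂ) f₀) with hf
  set g := bracketMul 1 (ρ 2 : ℂ) (besselMul (ρ 3 : ℂ) g₀) with hg
  have hfg : 0 ≤ l2Seminorm f * l2Seminorm g :=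
    mul_nonneg (apply_nonneg _ _) (apply_nonneg _ _)
  have hre : ∀ z i, (ζ z i).re = σ i + (τ i - σ i) * z.re := by
    intro z i
    simp only [hζ, Complex.add_re, Complex.re_ofReal_mul, Complex.ofReal_re]
  have him : ∀ z i, |(ζ z i).im| ≤ B * |z.im| := by
    intro z i
    have : (ζ z i).im = (τ i - σ i) * z.im := by
      simp only [hζ, Complex.add_im, Complex.im_ofReal_mul, Complex.ofReal_im, zero_add]
    rw [this, abs_mul]
    gcongr
    exact Finset.single_le_sum (f := fun i => |τ i - σ i|) (fun _ _ => abs_nonneg _)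
      (Finset.mem_univ i)
  have hbound : ∀ (y C : ℝ) (n : ℕ), 0 ≤ C → C ≤ C₀ + C₁ → n ≤ n₀ + n₁ →
      C * (1 + B * |y|) ^ n * (l2Seminorm f * l2Seminorm g)
        ≤ K * (l2Seminorm f * l2Seminorm g) * (1 + |y|) ^ (n₀ + n₁) := by
    intro y C n hC hCle hn
    have hy := abs_nonneg y
    calc _ ≤ (C₀ + C₁) * (1 + B * |y|) ^ (n₀ + n₁) * (l2Seminorm f * l2Seminorm g) := by
          gcongr
          nlinarith
      _ ≤ (C₀ + C₁) * ((1 + B) * (1 + |y|)) ^ (n₀ + n₁) * (l2Seminorm f * l2Seminorm g) := by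
          gcongr
          nlinarith
      _ = _ := by rw [mul_pow]; ring
  have hθ := (isStripCurve_conjugatedBilinear hT f g σ (fun i => τ i - σ i)).norm_toLp_le
    (A := K * (l2Seminorm f * l2Seminorm g)) (m := n₀ + n₁)
    (fun z hz => (h₀ (ζ z) (B * |z.im|) (fun i => by rw [hre, hz]; ring) (him z) f g).trans
      (hbound _ _ _ hC₀ (by linarith) (by omega)))
    (fun z hz => (h₁ (ζ z) (B * |z.im|) (fun i => by rw [hre, hz]; ring) (him z) f g).trans
      (hbound _ _ _ hC₁ (by linarith) (by omega)))
    ht (by linarith)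
  -- `f` and `g` are chosen such that `T` is applied to `f₀` and `g₀` at `z = t`.
  have hcancel : ∀ (a b : ℝ) (u : 𝓢(EuclideanSpace ℝ (Fin d), ℂ)),
      besselMul (-(b : ℂ)) (bracketMul 1 (-(a : ℂ)) (bracketMul 1 a (besselMul b u))) = u := by
    intro a b u
    rw [bracketMul_bracketMul, neg_add_cancel, bracketMul_zero, besselMul_besselMul,
      neg_add_cancel, besselMul_zero]
  have hend : conjugatedBilinear T f g (ζ t)
      = bracketMul 1 (ρ 4 : ℂ) (besselMul (ρ 5 : ℂ) (T f₀ g₀)) := by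
    rw [hζt, conjugatedBilinear, hf, hg, hcancel, hcancel]
  change ‖(conjugatedBilinear T f g (ζ t)).toLp 2 MeasureTheory.volume‖ ≤ _ at hθ
  rw [hend, ← l2Seminorm_apply, ← weightedSobolevNorm_eq] at hθ
  refine hθ.trans (le_of_eq ?_)
  rw [weightedSobolevNorm_eq d, weightedSobolevNorm_eq d, ← hf, ← hg]
  ring
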